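/- **Setting.** Let $d\in\{2,3\}$, $k_d=\binom d2$, and let $\Omega\subset\mathbb R^d$ be a bounded Lipschitz domain with $\partial\Omega=\partial_e\Omega\cup\partial_n\Omega$ (disjoint). For matrices $\tau$ let $\operatorname{asym}\tau=\tau_{21}-\tau_{12}$ if $d=2$ and $\operatorname{asym}\tau=(\tau_{32}-\tau_{23},\tau_{13}-\tau_{31},\tau_{21}-\tau_{12})$ if $d=3$. With constants $\mu_\sigma,\mu_\sigma^c,\mu_\omega,\mu^c_\omega>0$ and $\lambda_\sigma,\lambda_\omega\ge0$, let $\mathcal A_\sigma$ be the inverse of $\tau\mapsto 2\mu_\sigma\operatorname{sym}\tau+2\mu_\sigma^c\operatorname{skw}\tau+\lambda_\sigma(\operatorname{Tr}\tau)I$, and let $\mathcal A_\omega$ be the inverse of the analogous map with index $\omega$ if $d=3$, and of $\tau\mapsto2\mu_\omega\tau$ if $d=2$. Let $\ell\ge0$ be continuous on $\Omega$ with $\|\ell\|_{L^\infty(\Omega)}+\|\nabla\ell\|_{L^\infty(\Omega)}\lesssim1$. Let $X=\Sigma\times W$ and $Y=U\times R$, where $$\Sigma=\{\sigma\in L^2(\Omega)^{d\times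 d}:\nabla\cdot\sigma\in L^2,\ \sigma n=0\text{ on }\partial_e\Omega\},\qquad W=\{\omega\in L^2(\Omega)^{d\times k_d}:\nabla\cdot(\ell\omega)\in L^2,\ \ell\omega n=0\text{ on }\partial_e\Omega\},$$ $U=L^2(\Omega)^d$, $R=L^2(\Omega)^{k_d}$ (for $d=2$, $\omega$ is a vector field and $\nabla\cdot(\ell\omega)$ is scalar). Write $\|(\sigma,\omega)\|_\Omega^2=\|\sigma\|_\Omega^2+\|\omega\|_\Omega^2$, $\|(u,r)\|_Y^2=\|u\|_\Omega^2+\|r\|_\Omega^2$ for $L^2$ norms, and $\|(\sigma,\omega)\|_X^2=\|\sigma\|_\Omega^2+\|\nabla\cdot\sigma\|_\Omega^2+\|\omega\|_\Omega^2+\|\nabla\cdot\ell\omega\|_\Omega^2$. Put $$\langle A\eta,\eta'\rangle=(\mathcal A_\sigma\sigma,\sigma')_\Omega+(\mathcal A_\omega\omega,\omega')_\Omega,\qquad \langle B\eta,v'\rangle=-(\nabla\cdot\sigma,u')_\Omega+(\operatorname{asym}\sigma,r')_\Omega-(\nabla\cdot\ell\omega,r')_\Omega .$$ Given $g\in X'$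 and $f\in Y'$, let $(\eta,v)\in X\times Y$ satisfy $\langle A\eta,\eta'\rangle-\langle B\eta',v\rangle=\langle g,\eta'\rangle$ for all $\eta'\in X$ and $\langle B\eta,v'\rangle=\langle f,v'\rangle$ for all $v'\in Y$. **Discretization.** Let $\Omega_h$ be a conforming, shape-regular simplicial tessellation of $\Omega$ of mesh size $h$ (the largest element diameter), and $\mathbb P_k$ the discontinuous piecewise polynomials of degree at most $k$ on it. Let $X_h=\Sigma_h\times W_h$ and $Y_h=U_h\times R_h$, where $\Sigma_h\subseteq\Sigma$, $W_h\subseteq W$ consist of $\mathbb P_2$ fields and $U_h\subseteq U$, $R_h\subseteq R$ of $\mathbb P_1$ fields, and $\mathbb P_0^d\subseteq U_h$. Let $\Pi_R$ be the $L^2$ projection onto $R_h$ and $$\|\eta\|_{X_h}^2=\|\sigma\|_\Omega^2+\|\nabla\cdot\sigma\|_\Omega^2+\|\omega\|_\Omega^2+\|\Pi_R\nabla\cdot\ell\omega\|_\Omega^2 .$$ Let $Q$ be an elementwise quadrature rule, $(\phi,\phi')_Q=\sum_{\Delta\in\Omega_h}|\Delta|\sum_q w_q\,\phi|_\Delta(x_{\Delta,q})\cdot\phi'|_\Delta(x_{\Delta,q})$,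 whose finitely many weights $w_q\ge0$ and whose nodes $x_{\Delta,q}\in\Delta$, given by their barycentric coordinates, are the same for all elements and meshes (e.g. the vertex rule, or the rule with vertices and barycentre), let $\|\phi\|_Q=\sqrt{(\phi,\phi)_Q}$, and let $\langle A_h\eta_h,\eta_h'\rangle=(\mathcal A_\sigma\sigma_h,\sigma_h')_Q+(\mathcal A_\omega\omega_h,\omega_h')_Q$. The MFE method seeks $(\eta_h,v_h)\in X_h\times Y_h$ with $$\langle A\eta_h,\eta_h'\rangle-\langle B\eta_h',v_h\rangle+\langle B\eta_h,v_h'\rangle=\langle g,\eta_h'\rangle+\langle f,v_h'\rangle\qquad\forall(\eta_h',v_h')\in X_h\times Y_h,$$ and the MS-MFE method seeks $(\hat\eta_h,\hat v_h)\in X_h\times Y_h$ satisfying the same equations with $A_h$ in place of $A$. **Theorem.** Assume: 1. $\nabla\cdot\Sigma_h\subseteq U_h$, and $\Sigma_h\times U_h\times R_h$ is elasticity-stable: $$\inf_{0\neq(u_h,r_h)\in U_h\times R_h}\ \sup_{\sigma_h\in\Sigma_h}\frac{(\nabla\cdot\sigma_h,u_h)_\Omega+(\operatorname{asym}\sigma_h,r_h)_\Omega}{\|(\sigma_h,0)\|_X\,\|(u_h,r_h)\|_Y}\gtrsim1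 ;$$ 2. $\|\eta_h\|_Q\eqsim\|\eta_h\|_\Omega$ for all $\eta_h\in X_h$; 3. $(\eta_h,\phi_0)_Q=(\eta_h,\phi_0)_\Omega$ for all $\eta_h\in X_h$ and all $\phi_0\in\mathbb P_0^{d\times d}\times\mathbb P_0^{d\times k_d}$; 4. $\sigma$, $\omega$ and $\nabla\cdot\sigma$ belong to $H^1(\Omega)$, with norms $\lesssim1$; 5. the MFE solution satisfies $\|\eta_h-\eta\|_\Omega+\|v_h-v\|_Y\lesssim h$. Then the MS-MFE method has a unique solution $(\hat\eta_h,\hat v_h)$, and $$\|\hat\eta_h-\eta\|_{X_h}+\|\hat v_h-v\|_Y\lesssim h .$$ Here the constant in the conclusion depends only on $\Omega$, the boundary parts, the material parameters, the quadrature rule, the shape-regularity constant and the constants in the hypotheses; it is independent of $h$, of the length scale $\ell$, of the mesh, of the finite element spaces and of the data. -/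

import Mathlib

open MeasureTheory Set
open scoped ENNReal

noncomputable section

namespace Cosserat

/-! ### Value spaces and `L²` spaces -/

/-- Points of `ℝ^d`. -/
abbrev Pt (d : ℕ) := EuclideanSpace ℝ (Fin d)

/-- Vectors in `ℝ^m`. -/
abbrev Vec (m : ℕ) := EuclideanSpace ℝ (Fin m)

/-- `m × d` matrices with the Frobenius inner product; row `i` is a vector in `ℝ^d`. -/
abbrev Mat (m d : ℕ) := EuclideanSpace ℝ (Fin m × Fin d)

/-- `k_d = binom(d, 2)`, the number of components of a rotation. -/
abbrev rotDim (d : ℕ) : ℕ := d.choose 2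

/-- Square-integrable fields on `Ω` with values in `V`. -/
abbrev L2 {d : ℕ} (Ω : Set (Pt d)) (V : Type) [NormedAddCommGroup V] :=
  Lp V 2 (volume.restrict Ω)

/-- Pairs `η = (σ, ω)` of a Cauchy stress and a couple stress in `L²`.
The couple stress has `k_d` rows, each of them a vector in `ℝ^d`: a `3 × 3` matrix field if
`d = 3`, a single vector field if `d = 2`. -/
abbrev Stress {d : ℕ} (Ω : Set (Pt d)) := L2 Ω (Mat d d) × L2 Ω (Mat (rotDim d) d)

/-- Pairs `v = (u, r)` of a displacement and a rotation in `L²`, i.e. the space `Y`. -/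
abbrev Kinem {d : ℕ} (Ω : Set (Pt d)) := L2 Ω (Vec d) × L2 Ω (Vec (rotDim d))

/-- The Hilbert norm `(‖a‖² + ‖b‖²)^{1/2}` of a pair: `‖η‖_Ω` on stresses and `‖v‖_Y` on pairs
of a displacement and a rotation. -/
def pairNorm {F G : Type*} [Norm F] [Norm G] (p : F × G) : ℝ := √(‖p.1‖ ^ 2 + ‖p.2‖ ^ 2)

/-! ### Pointwise operators -/

/-- The asymmetry operator, in dimensions two and three. -/
def asym : (d : ℕ) → Mat d d → Vec (rotDim d)
  | 2, τ => WithLp.toLp 2 (show Fin 1 → ℝ from ![τ (1, 0) - τ (0, 1)])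
  | 3, τ => WithLp.toLp 2 (show Fin 3 → ℝ from
      ![τ (2, 1) - τ (1, 2), τ (0, 2) - τ (2, 0), τ (1, 0) - τ (0, 1)])
  | _, _ => 0

/-- The compliance tensor
`τ ↦ 1/(2μ) (sym τ - λ/(2μ + dλ) (tr τ) I) + 1/(2μᶜ) skw τ`, the inverse of
`τ ↦ 2μ sym τ + 2μᶜ skw τ + λ (tr τ) I`. -/
def compliance (d : ℕ) (mu muc lam : ℝ) (τ : Mat d d) : Mat d d :=
  WithLp.toLp 2 fun p =>
    1 / (2 * mu) * ((τ (p.1, p.2) + τ (p.2, p.1)) / 2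
      - lam / (2 * mu + d * lam) * (∑ i, τ (i, i)) * (if p.1 = p.2 then 1 else 0))
    + 1 / (2 * muc) * ((τ (p.1, p.2) - τ (p.2, p.1)) / 2)

/-- Material parameters of a Cosserat medium. -/
structure Material where
  muS : ℝ
  mucS : ℝ
  lamS : ℝ
  muW : ℝ
  mucW : ℝ
  lamW : ℝ
  muS_pos : 0 < muS
  mucS_pos : 0 < mucS
  lamS_nonneg : 0 ≤ lamS
  muW_pos : 0 < muW
  mucW_pos : 0 < mucW
  lamW_nonneg : 0 ≤ lamW

/-- `𝒜_σ`. -/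
def Material.AS (P : Material) (d : ℕ) : Mat d d → Mat d d :=
  compliance d P.muS P.mucS P.lamS

/-- `𝒜_ω`: the inverse of `τ ↦ 2μ sym τ + 2μᶜ skw τ + λ (tr τ) I` for `d = 3`, and of
`τ ↦ 2μ τ` for `d = 2`. -/
def Material.AW (P : Material) : (d : ℕ) → Mat (rotDim d) d → Mat (rotDim d) d
  | 3, τ => compliance 3 P.muW P.mucW P.lamW τ
  | _, τ => (1 / (2 * P.muW)) • τ

/-! ### Domains, weak derivatives, divergence with boundary condition -/

/-- A bounded Lipschitz domain: locally, after a rotation, the region strictly above the graph of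
a Lipschitz function. The function `γ` is constant in the direction `ν`, so it is a function of
the component orthogonal to `ν`. -/
def IsLipschitzDomain {d : ℕ} (Ω : Set (Pt d)) : Prop :=
  IsOpen Ω ∧ IsConnected Ω ∧ Bornology.IsBounded Ω ∧
  ∀ x ∈ frontier Ω, ∃ ν : Pt d, ‖ν‖ = 1 ∧ ∃ (K : NNReal) (γ : Pt d → ℝ),
    LipschitzWith K γ ∧ (∀ (y : Pt d) (t : ℝ), γ (y + t • ν) = γ y) ∧
    ∃ ρ > 0, ∀ y ∈ Metric.ball x ρ, (y ∈ Ω ↔ γ y < inner ℝ ν y)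

/-- The classical partial derivative `∂_j φ`. -/
def pderiv {d : ℕ} (j : Fin d) (φ : Pt d → ℝ) (x : Pt d) : ℝ :=
  fderiv ℝ φ x (EuclideanSpace.single j 1)

/-- `g` is the weak partial derivative `∂_j f` on `Ω`. -/
def HasWeakPartial {d : ℕ} (Ω : Set (Pt d)) (j : Fin d) (f g : Pt d → ℝ) : Prop :=
  ∀ φ : Pt d → ℝ, ContDiff ℝ (⊤ : ℕ∞) φ → HasCompactSupport φ → tsupport φ ⊆ Ω →
    ∫ x in Ω, f x * pderiv j φ x = - ∫ x in Ω, g x * φ x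

/-- The field `f` belongs to `H¹(Ω)` and `‖f‖_{1,Ω} ≤ M`. -/
def H1NormLE {d : ℕ} {ι : Type} [Fintype ι] (Ω : Set (Pt d))
    (f : L2 Ω (EuclideanSpace ℝ ι)) (M : ℝ) : Prop :=
  ∃ G : L2 Ω (EuclideanSpace ℝ (ι × Fin d)),
    (∀ k j, HasWeakPartial Ω j (fun x => f x k) (fun x => G x (k, j))) ∧
    √(‖f‖ ^ 2 + ‖G‖ ^ 2) ≤ M

/-- The length scale: continuous, non-negative, `‖ℓ‖_{L^∞(Ω)} + ‖∇ℓ‖_{L^∞(Ω)} ≤ L`. -/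
def IsLengthScale {d : ℕ} (Ω : Set (Pt d)) (L : ℝ) (ell : Pt d → ℝ) : Prop :=
  ContinuousOn ell Ω ∧ (∀ x ∈ Ω, 0 ≤ ell x) ∧
  ∃ G : Pt d → Pt d, AEStronglyMeasurable G (volume.restrict Ω) ∧
    (∀ j, HasWeakPartial Ω j ell (fun x => G x j)) ∧
    eLpNorm ell ∞ (volume.restrict Ω) + eLpNorm G ∞ (volume.restrict Ω) ≤ ENNReal.ofReal L

/-- `w` is the row-wise weak divergence of `τ` on `Ω`, and the normal trace of `τ` vanishes on
`∂Ω ∖ Γn`: Green's formula without boundary term holds for all smooth test functions that vanish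
near `Γn`. -/
def HasDiv {d m : ℕ} (Ω Γn : Set (Pt d)) (τ : Pt d → Mat m d) (w : L2 Ω (Vec m)) : Prop :=
  ∀ (i : Fin m) (φ : Pt d → ℝ), ContDiff ℝ (⊤ : ℕ∞) φ → HasCompactSupport φ →
    Disjoint (tsupport φ) Γn →
    ∫ x in Ω, w x i * φ x = - ∫ x in Ω, ∑ j, τ x (i, j) * pderiv j φ x

open Classical in
/-- The weak divergence `∇ · τ` (zero by convention if there is none in `L²`). -/
def wdiv {d m : ℕ} (Ω Γn : Set (Pt d)) (τ : Pt d → Mat m d) : L2 Ω (Vec m) :=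
  if h : ∃ w, HasDiv Ω Γn τ w then h.choose else 0

/-- `σ ∈ Σ`: square-integrable divergence, `σ n = 0` on the essential boundary. -/
def MemSigma {d : ℕ} (Ω Γn : Set (Pt d)) (σ : L2 Ω (Mat d d)) : Prop :=
  ∃ w, HasDiv Ω Γn σ w

/-- `ω ∈ W`: `ℓ ω` has a square-integrable divergence, `ℓ ω n = 0` on the essential boundary. -/
def MemW {d : ℕ} (Ω Γn : Set (Pt d)) (ell : Pt d → ℝ) (ω : L2 Ω (Mat (rotDim d) d)) : Prop :=
  ∃ w, HasDiv Ω Γn (fun x => ell x • ω x) w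

/-- `η ∈ X = Σ × W`. -/
def MemX {d : ℕ} (Ω Γn : Set (Pt d)) (ell : Pt d → ℝ) (η : Stress Ω) : Prop :=
  MemSigma Ω Γn η.1 ∧ MemW Ω Γn ell η.2

/-- `∇ · σ`. -/
def divS {d : ℕ} {Ω : Set (Pt d)} (Γn : Set (Pt d)) (σ : L2 Ω (Mat d d)) : L2 Ω (Vec d) :=
  wdiv Ω Γn σ

/-- `∇ · (ℓ ω)`. -/
def divW {d : ℕ} {Ω : Set (Pt d)} (Γn : Set (Pt d)) (ell : Pt d → ℝ)
    (ω : L2 Ω (Mat (rotDim d) d)) : L2 Ω (Vec (rotDim d)) :=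
  wdiv Ω Γn (fun x => ell x • ω x)

/-- The norm `‖η‖_X`. -/
def normX {d : ℕ} {Ω : Set (Pt d)} (Γn : Set (Pt d)) (ell : Pt d → ℝ) (η : Stress Ω) : ℝ :=
  √(‖η.1‖ ^ 2 + ‖divS Γn η.1‖ ^ 2 + ‖η.2‖ ^ 2 + ‖divW Γn ell η.2‖ ^ 2)

/-! ### The forms `A` and `B` and the continuous problem -/

/-- `⟨A η, η'⟩ = (𝒜_σ σ, σ')_Ω + (𝒜_ω ω, ω')_Ω`. -/
def formA {d : ℕ} {Ω : Set (Pt d)} (P : Material) (η η' : Stress Ω) : ℝ :=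
  (∫ x in Ω, inner ℝ (P.AS d (η.1 x)) (η'.1 x)) + ∫ x in Ω, inner ℝ (P.AW d (η.2 x)) (η'.2 x)

/-- `(asym σ, r)_Ω`. -/
def formAsym {d : ℕ} {Ω : Set (Pt d)} (σ : L2 Ω (Mat d d)) (r : L2 Ω (Vec (rotDim d))) : ℝ :=
  ∫ x in Ω, inner ℝ (asym d (σ x)) (r x)

/-- `⟨B η, v⟩ = -(∇ · σ, u)_Ω + (asym σ, r)_Ω - (∇ · ℓ ω, r)_Ω`. -/
def formB {d : ℕ} {Ω : Set (Pt d)} (Γn : Set (Pt d)) (ell : Pt d → ℝ)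
    (η : Stress Ω) (v : Kinem Ω) : ℝ :=
  -inner ℝ (divS Γn η.1) v.1 + formAsym η.1 v.2 - inner ℝ (divW Γn ell η.2) v.2

/-- `⟨f, v'⟩ = (f_σ, u')_Ω + (f_ω, r')_Ω`. -/
def loadF {d : ℕ} {Ω : Set (Pt d)} (f v' : Kinem Ω) : ℝ := inner ℝ f.1 v'.1 + inner ℝ f.2 v'.2

/-- The functional `g` is bounded on `X` for the norm of `X`, i.e. `g ∈ X'`. (A functional on the
subspace `X` is given by any linear extension; only its values on `X` are ever used.) -/
def IsDualX {d : ℕ} {Ω : Set (Pt d)} (Γn : Set (Pt d)) (ell : Pt d → ℝ)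
    (g : Stress Ω →ₗ[ℝ] ℝ) : Prop :=
  ∃ K : ℝ, ∀ η, MemX Ω Γn ell η → |g η| ≤ K * normX Γn ell η

/-- `(η, v) ∈ X × Y` solves the variational formulation of the Cosserat problem. -/
def IsSolution {d : ℕ} {Ω : Set (Pt d)} (Γn : Set (Pt d)) (P : Material) (ell : Pt d → ℝ)
    (g : Stress Ω →ₗ[ℝ] ℝ) (f : Kinem Ω) (η : Stress Ω) (v : Kinem Ω) : Prop :=
  MemX Ω Γn ell η ∧
  (∀ η', MemX Ω Γn ell η' → formA P η η' - formB Γn ell η' v = g η') ∧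
  (∀ v' : Kinem Ω, formB Γn ell η v' = loadF f v')

/-! ### Meshes, piecewise polynomials, finite element spaces -/

/-- The closed simplex spanned by the vertices of `T`. -/
def body {d : ℕ} (T : Affine.Simplex ℝ (Pt d) d) : Set (Pt d) :=
  convexHull ℝ (range T.points)

/-- A conforming simplicial tessellation of `Ω`. -/
structure Mesh {d : ℕ} (Ω : Set (Pt d)) where
  elems : Finset (Affine.Simplex ℝ (Pt d) d)
  closure_eq : closure Ω = ⋃ T ∈ elems, body T
  interior_subset : ∀ T ∈ elems, interior (body T) ⊆ Ω
  disjoint_interior : ∀ T ∈ elems, ∀ T' ∈ elems, T ≠ T' →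
    Disjoint (interior (body T)) (interior (body T'))
  inter_eq : ∀ T ∈ elems, ∀ T' ∈ elems,
    body T ∩ body T' = convexHull ℝ (range T.points ∩ range T'.points)

/-- The mesh size `h`, the largest diameter of an element. -/
def Mesh.size {d : ℕ} {Ω : Set (Pt d)} (𝒯 : Mesh Ω) : ℝ :=
  ⨆ T : 𝒯.elems, Metric.diam (body T.1)

/-- Shape regularity: each element contains a ball whose radius is at least the diameter of the
element divided by `κ`. -/
def Mesh.ShapeRegular {d : ℕ} {Ω : Set (Pt d)} (𝒯 : Mesh Ω) (κ : ℝ) : Prop :=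
  ∀ T ∈ 𝒯.elems, ∃ x : Pt d, ∃ ρ > 0,
    Metric.closedBall x ρ ⊆ body T ∧ Metric.diam (body T) ≤ κ * ρ

/-- The components of `f` on the element `T` are the polynomials `p`, of degree at most `k`. -/
def IsPolyOn {d : ℕ} {ι : Type} [Fintype ι] {Ω : Set (Pt d)} (k : ℕ)
    (T : Affine.Simplex ℝ (Pt d) d) (f : L2 Ω (EuclideanSpace ℝ ι))
    (p : ι → MvPolynomial (Fin d) ℝ) : Prop :=
  (∀ a, (p a).totalDegree ≤ k) ∧
  ∀ᵐ x ∂(volume.restrict (interior (body T))), ∀ a, f x a = MvPolynomial.eval (fun j => x j) (p a)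

/-- `f ∈ ℙ_k`: discontinuous piecewise polynomials (componentwise). -/
def IsPW {d : ℕ} {ι : Type} [Fintype ι] {Ω : Set (Pt d)} (𝒯 : Mesh Ω) (k : ℕ)
    (f : L2 Ω (EuclideanSpace ℝ ι)) : Prop :=
  ∀ T ∈ 𝒯.elems, ∃ p, IsPolyOn k T f p

open Classical in
/-- The restriction of `f ∈ ℙ₂` to the element `T`, as a polynomial. -/
def elemPoly {d : ℕ} {ι : Type} [Fintype ι] {Ω : Set (Pt d)} (T : Affine.Simplex ℝ (Pt d) d)
    (f : L2 Ω (EuclideanSpace ℝ ι)) : ι → MvPolynomial (Fin d) ℝ :=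
  if h : ∃ p, IsPolyOn 2 T f p then h.choose else 0

/-- The value `f_T(x)` of the restriction of `f ∈ ℙ₂` to the element `T`. -/
def elemVal {d : ℕ} {ι : Type} [Fintype ι] {Ω : Set (Pt d)} (T : Affine.Simplex ℝ (Pt d) d)
    (f : L2 Ω (EuclideanSpace ℝ ι)) (x : Pt d) : EuclideanSpace ℝ ι :=
  WithLp.toLp 2 fun a => MvPolynomial.eval (fun j => x j) (elemPoly T f a)

/-- Conforming finite element spaces `Σ_h ⊆ Σ ∩ ℙ₂`, `W_h ⊆ W ∩ ℙ₂`, `U_h ⊆ ℙ₁`,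
`R_h ⊆ ℙ₁`. -/
structure FESpaces {d : ℕ} {Ω : Set (Pt d)} (Γn : Set (Pt d)) (ell : Pt d → ℝ)
    (𝒯 : Mesh Ω) where
  Sh : Submodule ℝ (L2 Ω (Mat d d))
  Wh : Submodule ℝ (L2 Ω (Mat (rotDim d) d))
  Uh : Submodule ℝ (L2 Ω (Vec d))
  Rh : Submodule ℝ (L2 Ω (Vec (rotDim d)))
  Sh_conf : ∀ σ ∈ Sh, MemSigma Ω Γn σ
  Wh_conf : ∀ ω ∈ Wh, MemW Ω Γn ell ω
  Sh_poly : ∀ σ ∈ Sh, IsPW 𝒯 2 σ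
  Wh_poly : ∀ ω ∈ Wh, IsPW 𝒯 2 ω
  Uh_poly : ∀ u ∈ Uh, IsPW 𝒯 1 u
  Rh_poly : ∀ r ∈ Rh, IsPW 𝒯 1 r

section Discrete

variable {d : ℕ} {Ω Γn : Set (Pt d)} {ell : Pt d → ℝ} {𝒯 : Mesh Ω}

/-- `X_h = Σ_h × W_h`. -/
def FESpaces.Xh (S : FESpaces Γn ell 𝒯) : Submodule ℝ (Stress Ω) := S.Sh.prod S.Wh

/-- `Y_h = U_h × R_h`. -/
def FESpaces.Yh (S : FESpaces Γn ell 𝒯) : Submodule ℝ (Kinem Ω) := S.Uh.prod S.Rh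

open Classical in
/-- The orthogonal projection of `z` onto the subspace `K` (which is finite-dimensional wherever
this is used; zero by convention if `z` has no projection). -/
def l2Proj {H : Type*} [NormedAddCommGroup H] [InnerProductSpace ℝ H] (K : Submodule ℝ H)
    (z : H) : H :=
  if h : ∃ p ∈ K, ∀ q ∈ K, inner ℝ (z - p) q = 0 then h.choose else 0

/-- The discrete norm `‖η‖_{X_h}`, with `Π_R ∇ · ℓ ω` in place of `∇ · ℓ ω`. -/
def FESpaces.normXh (S : FESpaces Γn ell 𝒯) (η : Stress Ω) : ℝ :=
  √(‖η.1‖ ^ 2 + ‖divS Γn η.1‖ ^ 2 + ‖η.2‖ ^ 2 + ‖l2Proj S.Rh (divW Γn ell η.2)‖ ^ 2)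

/-- The triplet `Σ_h × U_h × R_h` is elasticity-stable, with inf-sup constant at least `β`. -/
def FESpaces.ElasticityStable (S : FESpaces Γn ell 𝒯) (β : ℝ) : Prop :=
  ∀ v ∈ S.Yh, v ≠ 0 →
    β ≤ ⨆ σ : S.Sh, (inner ℝ (divS Γn σ.1) v.1 + formAsym σ.1 v.2) /
      (normX Γn ell (σ.1, 0) * pairNorm v)

/-- `(η_h, v_h)` solves the mixed finite element problem. -/
def FESpaces.IsMFE (S : FESpaces Γn ell 𝒯) (P : Material)
    (g : Stress Ω →ₗ[ℝ] ℝ) (f : Kinem Ω) (η : Stress Ω) (v : Kinem Ω) : Prop :=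
  η ∈ S.Xh ∧ v ∈ S.Yh ∧ ∀ η' ∈ S.Xh, ∀ v' ∈ S.Yh,
    formA P η η' - formB Γn ell η' v + formB Γn ell η v' = g η' + loadF f v'

end Discrete

/-! ### Quadrature and the multipoint stress method -/

/-- An elementwise quadrature rule, given on a simplex by the barycentric coordinates of its nodes
and by non-negative weights relative to the volume of the simplex. -/
structure QuadRule (d : ℕ) (κ : Type) where
  node : κ → Fin (d + 1) → ℝ
  weight : κ → ℝ
  node_mem : ∀ q, node q ∈ stdSimplex ℝ (Fin (d + 1))
  weight_nonneg : ∀ q, 0 ≤ weight q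

/-- The vertex rule `Q₁`. -/
def QuadRule.Q1 (d : ℕ) : QuadRule d (Fin (d + 1)) where
  node q := Pi.single q 1
  weight _ := 1 / (d + 1)
  node_mem q := single_mem_stdSimplex ℝ q
  weight_nonneg _ := by positivity

/-- The rule `Q₂`, with the vertices (`some q`) and the barycentre (`none`) as nodes. -/
def QuadRule.Q2 (d : ℕ) : QuadRule d (Option (Fin (d + 1))) where
  node o := o.elim (fun _ => 1 / (d + 1)) (fun q => Pi.single q 1)
  weight o := o.elim ((d + 1) / (d + 2)) (fun _ => 1 / ((d + 2) * (d + 1)))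
  node_mem o := by
    cases o with
    | none =>
      refine ⟨fun _ => ?_, ?_⟩
      · simp only [Option.elim]; positivity
      · simp only [Option.elim, Finset.sum_const, Finset.card_univ, Fintype.card_fin, nsmul_eq_mul]
        push_cast
        field_simp
    | some q => exact single_mem_stdSimplex ℝ q
  weight_nonneg o := by cases o <;> simp only [Option.elim] <;> positivity

section Quadrature

variable {d : ℕ} {Ω Γn : Set (Pt d)} {ell : Pt d → ℝ} {κ : Type} [Fintype κ]

/-- The `q`-th quadrature node of the element `T`. -/
def QuadRule.pt (Q : QuadRule d κ) (T : Affine.Simplex ℝ (Pt d) d) (q : κ) : Pt d :=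
  ∑ j, Q.node q j • T.points j

/-- `(F φ, φ')_Q = ∑_T |T| ∑_q w_q F(φ_T(x_q)) · φ'_T(x_q)`, for a linear map `F` of values that
does not depend on the position. -/
def QuadRule.form {ι : Type} [Fintype ι] (Q : QuadRule d κ) (𝒯 : Mesh Ω)
    (F : EuclideanSpace ℝ ι → EuclideanSpace ℝ ι) (φ φ' : L2 Ω (EuclideanSpace ℝ ι)) : ℝ :=
  ∑ T ∈ 𝒯.elems, volume.real (body T) *
    ∑ q, Q.weight q * inner ℝ (F (elemVal T φ (Q.pt T q))) (elemVal T φ' (Q.pt T q))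

/-- `(η, η')_Q`. -/
def QuadRule.ip (Q : QuadRule d κ) (𝒯 : Mesh Ω) (η η' : Stress Ω) : ℝ :=
  Q.form 𝒯 id η.1 η'.1 + Q.form 𝒯 id η.2 η'.2

/-- `‖η‖_Q`. -/
def QuadRule.norm (Q : QuadRule d κ) (𝒯 : Mesh Ω) (η : Stress Ω) : ℝ := √(Q.ip 𝒯 η η)

/-- `⟨A_h η, η'⟩ = (𝒜_σ σ, σ')_Q + (𝒜_ω ω, ω')_Q`. -/
def QuadRule.formAh (Q : QuadRule d κ) (𝒯 : Mesh Ω) (P : Material) (η η' : Stress Ω) : ℝ :=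
  Q.form 𝒯 (P.AS d) η.1 η'.1 + Q.form 𝒯 (P.AW d) η.2 η'.2

/-- The norm equivalence `c₁ ‖η_h‖_Ω ≤ ‖η_h‖_Q ≤ c₂ ‖η_h‖_Ω` on `X_h`. -/
def QuadRule.NormEquiv {𝒯 : Mesh Ω} (Q : QuadRule d κ) (S : FESpaces Γn ell 𝒯)
    (c₁ c₂ : ℝ) : Prop :=
  ∀ η ∈ S.Xh, c₁ * pairNorm η ≤ Q.norm 𝒯 η ∧ Q.norm 𝒯 η ≤ c₂ * pairNorm η

/-- Exactness on `X_h` against piecewise constants. -/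
def QuadRule.Exact {𝒯 : Mesh Ω} (Q : QuadRule d κ) (S : FESpaces Γn ell 𝒯) : Prop :=
  ∀ η ∈ S.Xh, ∀ φ : Stress Ω, IsPW 𝒯 0 φ.1 → IsPW 𝒯 0 φ.2 →
    Q.ip 𝒯 η φ = inner ℝ η.1 φ.1 + inner ℝ η.2 φ.2

/-- `(η_h, v_h)` solves the multipoint stress mixed finite element problem. -/
def FESpaces.IsMSMFE {𝒯 : Mesh Ω} (S : FESpaces Γn ell 𝒯) (Q : QuadRule d κ) (P : Material)
    (g : Stress Ω →ₗ[ℝ] ℝ) (f : Kinem Ω) (η : Stress Ω) (v : Kinem Ω) : Prop :=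
  η ∈ S.Xh ∧ v ∈ S.Yh ∧ ∀ η' ∈ S.Xh, ∀ v' ∈ S.Yh,
    Q.formAh 𝒯 P η η' - formB Γn ell η' v + formB Γn ell η v' = g η' + loadF f v'

end Quadrature

end Cosserat

end

noncomputable section

namespace Cosserat

/-! ### The Poincaré inequality on convex sets -/

/-! The multipoint solution is compared with the MFE solution, whose error is already of order h.
Put e = η̂_h − η_h and w = v̂_h − v_h. Subtracting the two discrete systems shows that (e, w) solves
the MS-MFE system with right-hand side F(η') = ⟨A η_h, η'⟩ − ⟨A_h η_h, η'⟩. Hence two facts suffice: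
stability of the MS-MFE system, and F = O(h) for the L² norm of η'.

Stability (`FESpaces.stability`). Testing with (e, w) cancels the two B-terms, and A_h is coercive
on X_h because the compliance tensors are coercive pointwise (`compliance_coercive`) and the
quadrature norm dominates the L² norm on X_h. This bounds e. For w the inf-sup condition of the
elasticity triplet is enough: with η' = (σ_h, 0) the couple stress part of B disappears, so the
length scale enters no constant. Stability with zero data also makes the square finite-dimensional
system uniquely solvable.

Consistency (`QuadRule.abs_integral_sub_form_le`). Let φ be a piecewise constant approximation of η.
The tensors are constant, so Aφ is piecewise constant too and the quadrature integrates it exactly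
against X_h. Only η_h − φ contributes to F. Since φ need not belong to X_h, the assumed norm
equivalence does not apply to η_h − φ; instead the quadrature norm is bounded by the L² norm on all
piecewise quadratics, by scaling on shape-regular elements (`QuadRule.exists_form_id_le`). Finally
‖η_h − φ‖ ≤ ‖η_h − η‖ + ‖η − φ‖ = O(h), the last term by a Poincaré inequality on each simplex, with
a constant that depends on the dimension only (`exists_isPW_zero_norm_sub_le`).

Divergences (`FESpaces.normXh_sub_le`). The second equation says that B(η̂_h − η, ·) vanishes on
Y_h. As ∇·Σ_h ⊆ U_h, the error of ∇·σ is at most its distance to any element of U_h, in particular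
to a piecewise constant. The projected error of ∇·ℓω equals the projection of the asymmetry of the
stress error, which is controlled by the L² error of σ. -/

/-- Cauchy–Schwarz for the splitting w h = √w · (√w h). It serves with w = 1 along a segment and
with w a mollifier of mass one, where it is Jensen's inequality. -/
theorem sq_lintegral_mul_le {α : Type*} [MeasurableSpace α] {μ : Measure α} {w h : α → ℝ≥0∞}
    (hw : AEMeasurable w μ) (hh : AEMeasurable h μ) :
    (∫⁻ a, w a * h a ∂μ) ^ 2 ≤ (∫⁻ a, w a ∂μ) * ∫⁻ a, w a * h a ^ 2 ∂μ := by
  have key := ENNReal.lintegral_mul_le_Lp_mul_Lq μ Real.HolderConjugate.two_two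
    (f := fun a => w a ^ (1 / 2 : ℝ)) (g := fun a => w a ^ (1 / 2 : ℝ) * h a)
    (hw.pow_const _) ((hw.pow_const _).mul hh)
  have half : ∀ x : ℝ≥0∞, x ^ (1 / 2 : ℝ) * x ^ (1 / 2 : ℝ) = x := fun x => by
    rw [← ENNReal.rpow_add_of_nonneg _ _ (by norm_num) (by norm_num)]; norm_num
  have sq : ∀ x : ℝ≥0∞, (x ^ (1 / 2 : ℝ)) ^ 2 = x := fun x => by rw [pow_two, half]
  have e1 : ∀ a, (w a ^ (1 / 2 : ℝ)) ^ (2 : ℝ) = w a := fun a => by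
    rw [ENNReal.rpow_two, sq]
  have e2 : ∀ a, (w a ^ (1 / 2 : ℝ) * h a) ^ (2 : ℝ) = w a * h a ^ 2 := fun a => by
    rw [ENNReal.rpow_two, mul_pow, sq]
  simp only [Pi.mul_apply, ← mul_assoc, half, e1, e2] at key
  calc (∫⁻ a, w a * h a ∂μ) ^ 2
      ≤ ((∫⁻ a, w a ∂μ) ^ (1 / 2 : ℝ) * (∫⁻ a, w a * h a ^ 2 ∂μ) ^ (1 / 2 : ℝ)) ^ 2 := by gcongr
    _ = _ := by rw [mul_pow, sq, sq]

theorem lintegral_comp_smul_add_le {d : ℕ} {g : Pt d → ℝ≥0∞} (hg : Measurable g) {t : ℝ}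
    (ht : 1 / 2 ≤ t) (y : Pt d) :
    ∫⁻ x, g (t • x + y) ≤ 2 ^ d * ∫⁻ x, g x := by
  have ht0 : t ≠ 0 := by linarith
  have hm : Measurable fun x : Pt d => g (x + y) := hg.comp (measurable_add_const y)
  rw [← lintegral_map hm (measurable_const_smul t), Measure.map_addHaar_smul _ ht0,
    lintegral_smul_measure, lintegral_add_right_eq_self g y, smul_eq_mul, finrank_euclideanSpace,
    Fintype.card_fin]
  gcongr
  have : |(t ^ d)⁻¹| ≤ 2 ^ d := by
    rw [abs_of_nonneg (by positivity), ← inv_pow]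
    gcongr
    rw [inv_le_comm₀ (by linarith) (by norm_num)]
    linarith
  calc ENNReal.ofReal |(t ^ d)⁻¹| ≤ ENNReal.ofReal (2 ^ d) := ENNReal.ofReal_le_ofReal this
    _ = 2 ^ d := by rw [ENNReal.ofReal_pow (by norm_num)]; norm_num

/-- Mean value inequality along a segment, in `L²` form. -/
theorem enorm_sub_sq_le_lintegral {E : Type*} [NormedAddCommGroup E] [NormedSpace ℝ E]
    {f : E → ℝ} (hf : ContDiff ℝ 1 f) (x y : E) :
    ‖f y - f x‖ₑ ^ 2 ≤
      ‖y - x‖ₑ ^ 2 * ∫⁻ t in Ioc (0 : ℝ) 1, ‖fderiv ℝ f (x + t • (y - x))‖ₑ ^ 2 := by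
  have hc : Continuous fun t : ℝ => fderiv ℝ f (x + t • (y - x)) :=
    (hf.continuous_fderiv (by norm_num)).comp (by fun_prop)
  have hc' : Continuous fun t : ℝ => fderiv ℝ f (x + t • (y - x)) (y - x) :=
    hc.clm_apply continuous_const
  have hd : ∀ t ∈ uIcc (0 : ℝ) 1, HasDerivAt (fun t : ℝ => f (x + t • (y - x)))
      (fderiv ℝ f (x + t • (y - x)) (y - x)) t := fun t _ => by
    have h1 := (hf.differentiable (by norm_num) (x + t • (y - x))).hasFDerivAt
    have h2 : HasDerivAt (fun t : ℝ => x + t • (y - x)) (y - x) t := by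
      simpa using ((hasDerivAt_id t).smul_const (y - x)).const_add x
    exact h1.comp_hasDerivAt t h2
  have h := intervalIntegral.integral_eq_sub_of_hasDerivAt hd (hc'.intervalIntegrable _ _)
  simp only [one_smul, zero_smul, add_zero, add_sub_cancel] at h
  rw [intervalIntegral.integral_of_le zero_le_one] at h
  rw [← h]
  have hmeas : AEMeasurable (fun t : ℝ => ‖fderiv ℝ f (x + t • (y - x))‖ₑ)
      (volume.restrict (Ioc (0 : ℝ) 1)) := hc.enorm.measurable.aemeasurable
  calc ‖∫ t in Ioc (0 : ℝ) 1, fderiv ℝ f (x + t • (y - x)) (y - x)‖ₑ ^ 2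
      ≤ (∫⁻ t in Ioc (0 : ℝ) 1, ‖y - x‖ₑ * ‖fderiv ℝ f (x + t • (y - x))‖ₑ) ^ 2 := by
        gcongr
        refine (enorm_integral_le_lintegral_enorm _).trans (lintegral_mono fun t => ?_)
        rw [mul_comm]
        exact ContinuousLinearMap.le_opENorm _ _
    _ = ‖y - x‖ₑ ^ 2 * (∫⁻ t in Ioc (0 : ℝ) 1, 1 * ‖fderiv ℝ f (x + t • (y - x))‖ₑ) ^ 2 := by
        rw [lintegral_const_mul'' _ hmeas, mul_pow]; simp
    _ ≤ _ := by
        gcongr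
        refine (sq_lintegral_mul_le aemeasurable_const hmeas).trans ?_
        simp

/-- The difference f(y) − f(x) is bounded by the gradient on the segment from x to y, which
convexity keeps inside K. Extending the gradient by zero allows the affine substitutions to be made
on the whole space. -/
theorem lintegral_lintegral_enorm_sub_sq_le {d : ℕ} {K : Set (Pt d)} (hK : Convex ℝ K)
    (hKm : MeasurableSet K) {D : ℝ≥0∞} (hD : ∀ x ∈ K, ∀ y ∈ K, ‖y - x‖ₑ ≤ D)
    {f : Pt d → ℝ} (hf : ContDiff ℝ 1 f) :
    ∫⁻ x in K, ∫⁻ y in K, ‖f y - f x‖ₑ ^ 2 ≤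
      D ^ 2 * (2 ^ d * volume K * ∫⁻ x in K, ‖fderiv ℝ f x‖ₑ ^ 2) := by
  set g : Pt d → ℝ≥0∞ := K.indicator fun x => ‖fderiv ℝ f x‖ₑ ^ 2 with hg
  have hgm : Measurable g :=
    ((hf.continuous_fderiv (by norm_num)).enorm.measurable.pow_const 2).indicator hKm
  have hgI : ∫⁻ x, g x = ∫⁻ x in K, ‖fderiv ℝ f x‖ₑ ^ 2 := lintegral_indicator hKm _
  have h1 : ∀ x ∈ K, ∀ y ∈ K, ‖f y - f x‖ₑ ^ 2 ≤
      D ^ 2 * ∫⁻ t in Ioc (0 : ℝ) 1, g (x + t • (y - x)) := fun x hx y hy => by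
    refine (enorm_sub_sq_le_lintegral hf x y).trans ?_
    refine mul_le_mul' (pow_le_pow_left₀ zero_le (hD x hx y hy) 2) ?_
    refine setLIntegral_mono' (s := Ioc (0 : ℝ) 1) measurableSet_Ioc fun t ht => ?_
    rw [hg, indicator_of_mem]
    exact hK.add_smul_sub_mem hx hy ⟨ht.1.le, ht.2⟩
  have hgm3 : Measurable fun p : (Pt d × Pt d) × ℝ => g (p.1.1 + p.2 • (p.1.2 - p.1.1)) :=
    hgm.comp (by fun_prop)
  have h2 : ∀ t ∈ Ioc (0 : ℝ) 1, ∫⁻ x in K, ∫⁻ y in K, g (x + t • (y - x)) ≤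
      2 ^ d * volume K * ∫⁻ x, g x := fun t ht => by
    have hgt : Measurable fun p : Pt d × Pt d => g (p.1 + t • (p.2 - p.1)) :=
      hgm.comp (by fun_prop)
    -- The point x + t(y − x) depends on y with factor t and on x with factor 1 − t. Integrating
    -- first in the variable whose factor is at least 1/2 keeps the Jacobian below 2^d.
    rcases le_total (1 / 2 : ℝ) t with h | h
    · calc ∫⁻ x in K, ∫⁻ y in K, g (x + t • (y - x))
          ≤ ∫⁻ x in K, 2 ^ d * ∫⁻ x, g x := by
            refine lintegral_mono fun x => (setLIntegral_le_lintegral _ _).trans ?_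
            refine (le_of_eq ?_).trans (lintegral_comp_smul_add_le hgm h (x - t • x))
            congr with y; congr 1; module
        _ = _ := by simp; ring
    · rw [lintegral_lintegral_swap hgt.aemeasurable]
      calc ∫⁻ y in K, ∫⁻ x in K, g (x + t • (y - x))
          ≤ ∫⁻ y in K, 2 ^ d * ∫⁻ x, g x := by
            refine lintegral_mono fun y => (setLIntegral_le_lintegral _ _).trans ?_
            refine (le_of_eq ?_).trans
              (lintegral_comp_smul_add_le (t := 1 - t) hgm (by linarith) (t • y))
            congr with x; congr 1; module
        _ = _ := by simp; ring
  calc ∫⁻ x in K, ∫⁻ y in K, ‖f y - f x‖ₑ ^ 2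
      ≤ ∫⁻ x in K, ∫⁻ y in K, D ^ 2 * ∫⁻ t in Ioc (0 : ℝ) 1, g (x + t • (y - x)) :=
        setLIntegral_mono' hKm fun x hx => setLIntegral_mono' hKm fun y hy => h1 x hx y hy
    _ = D ^ 2 * ∫⁻ x in K, ∫⁻ y in K, ∫⁻ t in Ioc (0 : ℝ) 1, g (x + t • (y - x)) := by
        have hm2 : Measurable fun p : Pt d × Pt d =>
            ∫⁻ t in Ioc (0 : ℝ) 1, g (p.1 + t • (p.2 - p.1)) := hgm3.lintegral_prod_right'
        rw [← lintegral_const_mul _ hm2.lintegral_prod_right']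
        refine lintegral_congr fun x => ?_
        exact lintegral_const_mul _ (hm2.comp measurable_prodMk_left)
    _ = D ^ 2 * ∫⁻ t in Ioc (0 : ℝ) 1, ∫⁻ x in K, ∫⁻ y in K, g (x + t • (y - x)) := by
        congr 1
        have : ∀ x : Pt d, ∫⁻ y in K, ∫⁻ t in Ioc (0 : ℝ) 1, g (x + t • (y - x)) =
            ∫⁻ t in Ioc (0 : ℝ) 1, ∫⁻ y in K, g (x + t • (y - x)) := fun x =>
          lintegral_lintegral_swap (hgm.comp (by fun_prop)).aemeasurable
        simp_rw [this]
        refine lintegral_lintegral_swap (Measurable.aemeasurable ?_)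
        exact Measurable.lintegral_prod_right'
          (f := fun p : (Pt d × ℝ) × Pt d => g (p.1.1 + p.1.2 • (p.2 - p.1.1)))
          (hgm.comp (by fun_prop))
    _ ≤ D ^ 2 * ∫⁻ t in Ioc (0 : ℝ) 1, 2 ^ d * volume K * ∫⁻ x, g x := by
        gcongr 1
        exact setLIntegral_mono' measurableSet_Ioc h2
    _ = _ := by rw [hgI]; simp

/-- Expanding a vector in the standard basis and applying Cauchy–Schwarz replaces the operator norm
of the derivative by partial derivatives, the only data in `HasWeakPartial`. -/
theorem norm_sq_le_sum_single {d : ℕ} (A : Pt d →L[ℝ] ℝ) :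
    ‖A‖ ^ 2 ≤ ∑ j, A (EuclideanSpace.single j 1) ^ 2 := by
  set s := ∑ j, A (EuclideanSpace.single j 1) ^ 2
  have hs : 0 ≤ s := Finset.sum_nonneg fun j _ => sq_nonneg _
  have : ‖A‖ ≤ √s := by
    refine A.opNorm_le_bound (Real.sqrt_nonneg _) fun v => ?_
    have hv : A v = ∑ j, v j * A (EuclideanSpace.single j 1) := by
      conv_lhs => rw [← (EuclideanSpace.basisFun (Fin d) ℝ).sum_repr v]
      simp
    rw [Real.norm_eq_abs, ← Real.sqrt_sq_eq_abs, EuclideanSpace.norm_eq,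
      ← Real.sqrt_mul hs]
    refine Real.sqrt_le_sqrt ?_
    rw [hv, mul_comm]
    refine (Finset.sum_mul_sq_le_sq_mul_sq _ _ _).trans (le_of_eq ?_)
    simp [s]
  calc ‖A‖ ^ 2 ≤ √s ^ 2 := by gcongr
    _ = s := Real.sq_sqrt hs

theorem enorm_sq_le_sum_single {d : ℕ} (A : Pt d →L[ℝ] ℝ) :
    ‖A‖ₑ ^ 2 ≤ ∑ j, ‖A (EuclideanSpace.single j 1)‖ₑ ^ 2 := by
  have h := ENNReal.ofReal_le_ofReal (norm_sq_le_sum_single A)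
  rw [ENNReal.ofReal_sum_of_nonneg fun j _ => sq_nonneg _, ENNReal.ofReal_pow (norm_nonneg _),
    ofReal_norm] at h
  refine h.trans (Finset.sum_le_sum fun j _ => ?_)
  rw [← ofReal_norm, ← ENNReal.ofReal_pow (norm_nonneg _), Real.norm_eq_abs, sq_abs]

/-- The points of `K` at distance at least `r` from the complement of `K`. -/
def erosion {E : Type*} [PseudoMetricSpace E] (K : Set E) (r : ℝ) : Set E :=
  {x | ∀ y ∉ K, r ≤ dist x y}

theorem isClosed_erosion {E : Type*} [PseudoMetricSpace E] (K : Set E) (r : ℝ) :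
    IsClosed (erosion K r) := by
  have : erosion K r = ⋂ y ∈ Kᶜ, {x | r ≤ dist x y} := by ext; simp [erosion]
  rw [this]
  exact isClosed_biInter fun y _ =>
    isClosed_le continuous_const (continuous_id.dist continuous_const)

theorem erosion_subset {E : Type*} [PseudoMetricSpace E] (K : Set E) {r : ℝ} (hr : 0 < r) :
    erosion K r ⊆ K := fun x hx => by
  by_contra h
  have := hx x h
  rw [dist_self] at this
  linarith

theorem closedBall_subset_of_mem_erosion {E : Type*} [PseudoMetricSpace E] {K : Set E} {r s : ℝ}
    (h : s < r) {x : E} (hx : x ∈ erosion K r) : Metric.closedBall x s ⊆ K := fun y hy => by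
  by_contra hyK
  have := hx y hyK
  rw [Metric.mem_closedBall, dist_comm] at hy
  linarith

/-- If z ∉ K were closer than r to ax + by, translating x and y by z − (ax + by) would leave both in
K, and convexity would put z in K. -/
theorem convex_erosion {E : Type*} [SeminormedAddCommGroup E] [NormedSpace ℝ E] {K : Set E}
    (hK : Convex ℝ K) (r : ℝ) : Convex ℝ (erosion K r) := by
  intro x hx y hy a b ha hb hab z hz
  by_contra! h
  refine hz ?_
  have key : ∀ p ∈ erosion K r, p + (z - (a • x + b • y)) ∈ K := fun p hp => by
    by_contra hpK
    have := hp _ hpK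
    rw [dist_eq_norm] at this h
    have e : p - (p + (z - (a • x + b • y))) = a • x + b • y - z := by abel
    rw [e] at this
    linarith
  have := hK (key x hx) (key y hy) ha hb hab
  convert this using 1
  rw [smul_add, smul_add, add_add_add_comm, ← add_smul, hab, one_smul]
  abel

theorem eventually_mem_erosion {E : Type*} [PseudoMetricSpace E] {K : Set E} (hK : IsOpen K)
    {x : E} (hx : x ∈ K) {r : ℕ → ℝ} (hr : Filter.Tendsto r Filter.atTop (nhds 0)) :
    ∀ᶠ n in Filter.atTop, x ∈ erosion K (r n) := by
  obtain ⟨ε, hε, hb⟩ := Metric.isOpen_iff.1 hK x hx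
  filter_upwards [hr.eventually (gt_mem_nhds hε)] with n hn y hy
  by_contra! h
  exact hy (hb (by rw [Metric.mem_ball, dist_comm]; linarith))

/-- The derivative of the mollification of a function with a weak gradient. -/
theorem fderiv_mollify_eq {d : ℕ} {Ω K : Set (Pt d)} (hΩ : MeasurableSet Ω)
    (hKΩ : K ⊆ Ω) {f g : Pt d → ℝ} (hf : IntegrableOn f Ω) {j : Fin d}
    (hw : HasWeakPartial Ω j f g) (ρ : ContDiffBump (0 : Pt d)) {x : Pt d}
    (hx : Metric.closedBall x ρ.rOut ⊆ K) :
    fderiv ℝ (convolution (ρ.normed volume) (Ω.indicator f) (ContinuousLinearMap.lsmul ℝ ℝ)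
      volume) x (EuclideanSpace.single j 1) = ∫ t, ρ.normed volume (x - t) * K.indicator g t := by
  have hfi : LocallyIntegrable (Ω.indicator f) volume :=
    ((integrable_indicator_iff hΩ).2 hf).locallyIntegrable
  have hρ : ContDiff ℝ 1 (ρ.normed volume) := ρ.contDiff_normed (n := 1)
  have hρc : HasCompactSupport (ρ.normed volume) := ρ.hasCompactSupport_normed
  -- The factors are exchanged so that the derivative falls on the smooth bump.
  rw [← convolution_flip]
  rw [(hρc.hasFDerivAt_convolution_right _ hfi hρ x).fderiv,
    convolution_precompR_apply _ hfi (hρc.fderiv ℝ) (hρ.continuous_fderiv (by norm_num))]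
  -- The reflected bump centred at x is the test function for the weak derivative. Its support lies
  -- in K, which makes it admissible and permits cutting g off outside K.
  set φ : Pt d → ℝ := fun t => ρ.normed volume (x - t) with hφ
  have hφs : ContDiff ℝ (⊤ : ℕ∞) φ := ρ.contDiff_normed.comp (contDiff_const.sub contDiff_id)
  have hsub : Function.support φ ⊆ Metric.closedBall x ρ.rOut := fun t ht => by
    have : x - t ∈ Function.support (ρ.normed volume) := ht
    rw [ρ.support_normed_eq, Metric.mem_ball, dist_zero_right] at this
    rw [Metric.mem_closedBall, dist_comm, dist_eq_norm]
    exact this.le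
  have hts : tsupport φ ⊆ Metric.closedBall x ρ.rOut :=
    closure_minimal hsub Metric.isClosed_closedBall
  have hcs : HasCompactSupport φ := HasCompactSupport.intro (isCompact_closedBall x ρ.rOut)
    fun t ht => by by_contra h; exact ht (hsub h)
  have hpd : ∀ t, fderiv ℝ (ρ.normed volume) (x - t) (EuclideanSpace.single j 1) =
      -pderiv j φ t := fun t => by
    have h1 : HasFDerivAt φ ((fderiv ℝ (ρ.normed volume) (x - t)).comp
        (-ContinuousLinearMap.id ℝ (Pt d))) t :=
      (hρ.differentiable (by norm_num) (x - t)).hasFDerivAt.comp t ((hasFDerivAt_id t).const_sub x)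
    rw [pderiv, h1.fderiv]
    simp
  rw [convolution_def]
  simp only [ContinuousLinearMap.flip_apply, ContinuousLinearMap.lsmul_apply, smul_eq_mul, hpd]
  calc ∫ t, -pderiv j φ t * Ω.indicator f t
      = ∫ t, Ω.indicator (fun t => -(f t * pderiv j φ t)) t := by
        congr with t
        by_cases ht : t ∈ Ω
        · simp [ht]; ring
        · simp [ht]
    _ = -∫ t in Ω, f t * pderiv j φ t := by rw [integral_indicator hΩ, integral_neg]
    _ = ∫ t in Ω, g t * φ t := by rw [hw φ hφs hcs ((hts.trans hx).trans hKΩ), neg_neg]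
    _ = ∫ t, φ t * K.indicator g t := by
        rw [← integral_indicator hΩ]
        congr with t
        by_cases ht : t ∈ K
        · simp [ht, hKΩ ht, mul_comm]
        · have : φ t = 0 := by
            by_contra h
            exact ht (hx (hsub h))
          simp [ht, this]

theorem lintegral_ofReal_normed {d : ℕ} (ρ : ContDiffBump (0 : Pt d)) (c : Pt d) :
    ∫⁻ t, ENNReal.ofReal (ρ.normed volume (c - t)) = 1 := by
  rw [lintegral_sub_left_eq_self (fun t => ENNReal.ofReal (ρ.normed volume t)) c,
    ← ofReal_integral_eq_lintegral_ofReal ρ.integrable_normed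
      (Filter.Eventually.of_forall ρ.nonneg_normed), ρ.integral_normed, ENNReal.ofReal_one]

/-- Young's inequality for a kernel of mass one: Jensen at each x, then Tonelli and the symmetry of
the bump. -/
theorem lintegral_enorm_mollify_sq_le {d : ℕ} (ρ : ContDiffBump (0 : Pt d)) {g : Pt d → ℝ}
    (hg : Measurable g) :
    ∫⁻ x, ‖∫ t, ρ.normed volume (x - t) * g t‖ₑ ^ 2 ≤ ∫⁻ x, ‖g x‖ₑ ^ 2 := by
  have hρ : Measurable (ρ.normed (volume : Measure (Pt d))) := ρ.continuous_normed.measurable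
  have hm : ∀ x : Pt d, Measurable fun t => ENNReal.ofReal (ρ.normed volume (x - t)) := fun x =>
    (hρ.comp (measurable_const_sub x)).ennreal_ofReal
  calc ∫⁻ x, ‖∫ t, ρ.normed volume (x - t) * g t‖ₑ ^ 2
      ≤ ∫⁻ x, ∫⁻ t, ENNReal.ofReal (ρ.normed volume (x - t)) * ‖g t‖ₑ ^ 2 := by
        refine lintegral_mono fun x => ?_
        calc ‖∫ t, ρ.normed volume (x - t) * g t‖ₑ ^ 2
            ≤ (∫⁻ t, ENNReal.ofReal (ρ.normed volume (x - t)) * ‖g t‖ₑ) ^ 2 := by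
              refine pow_le_pow_left₀ zero_le
                ((enorm_integral_le_lintegral_enorm _).trans (le_of_eq ?_)) 2
              congr with t
              rw [enorm_mul, Real.enorm_of_nonneg (ρ.nonneg_normed _)]
          _ ≤ _ := by
              refine (sq_lintegral_mul_le (hm x).aemeasurable hg.enorm.aemeasurable).trans ?_
              rw [lintegral_ofReal_normed, one_mul]
    _ = ∫⁻ t, ∫⁻ x, ENNReal.ofReal (ρ.normed volume (x - t)) * ‖g t‖ₑ ^ 2 := by
        refine lintegral_lintegral_swap (Measurable.aemeasurable ?_)
        exact ((hρ.comp (measurable_fst.sub measurable_snd)).ennreal_ofReal).mul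
          ((hg.comp measurable_snd).enorm.pow_const 2)
    _ = ∫⁻ t, ‖g t‖ₑ ^ 2 := by
        refine lintegral_congr fun t => ?_
        have hm' : Measurable fun x => ENNReal.ofReal (ρ.normed volume (x - t)) :=
          (hρ.comp (measurable_sub_const t)).ennreal_ofReal
        rw [lintegral_mul_const _ hm']
        have : ∀ x, ρ.normed volume (x - t) = ρ.normed volume (t - x) := fun x => by
          rw [← ρ.normed_neg, neg_sub]
        simp_rw [this]
        rw [lintegral_ofReal_normed, one_mul]

open Filter Topology in
-- The smooth inequality is applied to mollifications on the erosions of K, which are again convex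
-- and on which the mollified gradient is the mollification of the weak gradient. Fatou's lemma
-- passes to the limit, so convergence almost everywhere is all that is needed.
theorem lintegral_lintegral_enorm_sub_sq_le_of_hasWeakPartial {d : ℕ} {Ω K : Set (Pt d)}
    (hΩ : MeasurableSet Ω) (hK : Convex ℝ K) (hKo : IsOpen K) (hKΩ : K ⊆ Ω) {D : ℝ≥0∞}
    (hD : ∀ x ∈ K, ∀ y ∈ K, ‖y - x‖ₑ ≤ D) {f : Pt d → ℝ} {G : Fin d → Pt d → ℝ}
    (hfm : Measurable f) (hGm : ∀ j, Measurable (G j))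
    (hf : IntegrableOn f Ω) (hw : ∀ j, HasWeakPartial Ω j f (G j)) :
    ∫⁻ x in K, ∫⁻ y in K, ‖f y - f x‖ₑ ^ 2 ≤
      D ^ 2 * (2 ^ d * volume K * ∑ j, ∫⁻ x in K, ‖G j x‖ₑ ^ 2) := by
  let r : ℕ → ℝ := fun n => 1 / ((n : ℝ) + 1)
  have hr0 : ∀ n, 0 < r n := fun n => by positivity
  have hr : Tendsto r atTop (𝓝 0) := tendsto_one_div_add_atTop_nhds_zero_nat
  -- The fixed ratio 2 between outer and inner radius is what the Lebesgue differentiation argument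
  -- for almost everywhere convergence asks for.
  let ρ : ℕ → ContDiffBump (0 : Pt d) := fun n =>
    ⟨r n / 2, r n, half_pos (hr0 n), half_lt_self (hr0 n)⟩
  -- Twice the mollification radius: `closedBall_subset_of_mem_erosion` needs a strict inequality to
  -- fit the closed ball of radius `r n` into K.
  let Kn : ℕ → Set (Pt d) := fun n => erosion K (2 * r n)
  have hKnm : ∀ n, MeasurableSet (Kn n) := fun n => (isClosed_erosion _ _).measurableSet
  have hKnK : ∀ n, Kn n ⊆ K := fun n => erosion_subset K (by linarith [hr0 n])
  have hfi : LocallyIntegrable (Ω.indicator f) volume :=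
    ((integrable_indicator_iff hΩ).2 hf).locallyIntegrable
  let fn : ℕ → Pt d → ℝ := fun n => convolution ((ρ n).normed volume) (Ω.indicator f)
    (ContinuousLinearMap.lsmul ℝ ℝ) volume
  have hfn : ∀ n, ContDiff ℝ 1 (fn n) := fun n =>
    (ρ n).hasCompactSupport_normed.contDiff_convolution_left (n := 1) _
      ((ρ n).contDiff_normed (n := 1)) hfi
  have hlim : ∀ᵐ x, Tendsto (fun n => fn n x) atTop (𝓝 (Ω.indicator f x)) :=
    ContDiffBump.ae_convolution_tendsto_right_of_locallyIntegrable (K := 2) hr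
      (Eventually.of_forall fun n => by simp [ρ]; linarith) hfi
  have hgrad : ∀ n, ∫⁻ x in Kn n, ‖fderiv ℝ (fn n) x‖ₑ ^ 2 ≤ ∑ j, ∫⁻ x in K, ‖G j x‖ₑ ^ 2 := by
    intro n
    have hGi : ∀ j, Measurable (K.indicator (G j)) := fun j => (hGm j).indicator hKo.measurableSet
    have hmol : ∀ j, Measurable fun x : Pt d =>
        ‖∫ t, (ρ n).normed volume (x - t) * K.indicator (G j) t‖ₑ ^ 2 := fun j => by
      refine Measurable.pow_const (Measurable.enorm ?_) 2
      refine StronglyMeasurable.measurable ?_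
      refine StronglyMeasurable.integral_prod_right'
        (f := fun p : Pt d × Pt d => (ρ n).normed volume (p.1 - p.2) * K.indicator (G j) p.2) ?_
      exact (((ρ n).continuous_normed.measurable.comp (measurable_fst.sub measurable_snd)).mul
        ((hGi j).comp measurable_snd)).stronglyMeasurable
    calc ∫⁻ x in Kn n, ‖fderiv ℝ (fn n) x‖ₑ ^ 2
        ≤ ∫⁻ x in Kn n, ∑ j, ‖∫ t, (ρ n).normed volume (x - t) * K.indicator (G j) t‖ₑ ^ 2 := by
          refine setLIntegral_mono' (hKnm n) fun x hx => ?_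
          refine (enorm_sq_le_sum_single _).trans (le_of_eq (Finset.sum_congr rfl fun j _ => ?_))
          rw [fderiv_mollify_eq hΩ hKΩ hf (hw j) (ρ n)
            (closedBall_subset_of_mem_erosion (by linarith [hr0 n] : r n < 2 * r n) hx)]
      _ ≤ ∑ j, ∫⁻ x, ‖∫ t, (ρ n).normed volume (x - t) * K.indicator (G j) t‖ₑ ^ 2 := by
          rw [lintegral_finsetSum _ fun j _ => hmol j]
          exact Finset.sum_le_sum fun j _ => setLIntegral_le_lintegral _ _
      _ ≤ ∑ j, ∫⁻ x in K, ‖G j x‖ₑ ^ 2 := by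
          refine Finset.sum_le_sum fun j _ => (lintegral_enorm_mollify_sq_le _ (hGi j)).trans ?_
          rw [← lintegral_indicator hKo.measurableSet]
          refine le_of_eq (lintegral_congr fun x => ?_)
          by_cases hx : x ∈ K <;> simp [hx]
  set B := D ^ 2 * (2 ^ d * volume K * ∑ j, ∫⁻ x in K, ‖G j x‖ₑ ^ 2)
  let F : ℕ → Pt d × Pt d → ℝ≥0∞ := fun n =>
    (Kn n ×ˢ Kn n).indicator fun p => ‖fn n p.2 - fn n p.1‖ₑ ^ 2
  have hpre : ∀ n, Measurable fun p : Pt d × Pt d => ‖fn n p.2 - fn n p.1‖ₑ ^ 2 := fun n =>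
    (((hfn n).continuous.measurable.comp measurable_snd).sub
      ((hfn n).continuous.measurable.comp measurable_fst)).enorm.pow_const 2
  have hFm : ∀ n, Measurable (F n) := fun n => (hpre n).indicator ((hKnm n).prod (hKnm n))
  have hFB : ∀ n, ∫⁻ p, F n p ≤ B := fun n => by
    rw [lintegral_indicator ((hKnm n).prod (hKnm n)), Measure.volume_eq_prod,
      ← Measure.prod_restrict, lintegral_prod _ (hpre n).aemeasurable]
    refine (lintegral_lintegral_enorm_sub_sq_le (convex_erosion hK _) (hKnm n)
      (fun x hx y hy => hD x (hKnK n hx) y (hKnK n hy)) (hfn n)).trans ?_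
    exact mul_le_mul_right (mul_le_mul' (mul_le_mul_right (measure_mono (hKnK n)) _) (hgrad n)) _
  have hpre' : Measurable fun p : Pt d × Pt d => ‖f p.2 - f p.1‖ₑ ^ 2 :=
    ((hfm.comp measurable_snd).sub (hfm.comp measurable_fst)).enorm.pow_const 2
  rw [← lintegral_prod (fun p : Pt d × Pt d => ‖f p.2 - f p.1‖ₑ ^ 2) hpre'.aemeasurable,
    Measure.prod_restrict, ← Measure.volume_eq_prod,
    ← lintegral_indicator (hKo.measurableSet.prod hKo.measurableSet)]
  -- Every pair of points of the open set K eventually lies in `Kn n ×ˢ Kn n`, so for almost every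
  -- such pair `F n` converges to the integrand.
  calc ∫⁻ p, (K ×ˢ K).indicator (fun p : Pt d × Pt d => ‖f p.2 - f p.1‖ₑ ^ 2) p
      ≤ ∫⁻ p, liminf (fun n => F n p) atTop := by
        refine lintegral_mono_ae ?_
        rw [Measure.volume_eq_prod]
        filter_upwards [Measure.quasiMeasurePreserving_fst.ae hlim,
          Measure.quasiMeasurePreserving_snd.ae hlim] with p h1 h2
        by_cases hp : p ∈ K ×ˢ K
        · rw [indicator_of_mem hp]
          rw [indicator_of_mem (hKΩ hp.1)] at h1
          rw [indicator_of_mem (hKΩ hp.2)] at h2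
          have hr2 : Tendsto (fun n => 2 * r n) atTop (𝓝 0) := by simpa using hr.const_mul 2
          have ht : Tendsto (fun n => ‖fn n p.2 - fn n p.1‖ₑ ^ 2) atTop
              (𝓝 (‖f p.2 - f p.1‖ₑ ^ 2)) :=
            ((ENNReal.continuous_pow 2).tendsto _).comp ((h2.sub h1).enorm)
          have ht' : Tendsto (fun n => F n p) atTop (𝓝 (‖f p.2 - f p.1‖ₑ ^ 2)) := by
            refine ht.congr' ?_
            filter_upwards [eventually_mem_erosion hKo hp.1 hr2,
              eventually_mem_erosion hKo hp.2 hr2] with n hn1 hn2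
            exact (indicator_of_mem (show p ∈ Kn n ×ˢ Kn n from ⟨hn1, hn2⟩)
              fun p : Pt d × Pt d => ‖fn n p.2 - fn n p.1‖ₑ ^ 2).symm
          exact ht'.liminf_eq.ge
        · rw [indicator_of_notMem hp]
          exact zero_le
    _ ≤ liminf (fun n => ∫⁻ p, F n p) atTop := lintegral_liminf_le hFm
    _ ≤ B := by
        refine (liminf_le_liminf (Eventually.of_forall hFB)).trans ?_
        simp

/-! ### Elements of a mesh -/

section Element

variable {d : ℕ} (T : Affine.Simplex ℝ (Pt d) d)

/-- The open simplex. -/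
def openBody : Set (Pt d) := interior (body T)

theorem isOpen_openBody : IsOpen (openBody T) := isOpen_interior

theorem measurableSet_openBody : MeasurableSet (openBody T) := (isOpen_openBody T).measurableSet

theorem isCompact_body : IsCompact (body T) := (finite_range T.points).isCompact_convexHull ℝ

theorem convex_body : Convex ℝ (body T) := convex_convexHull ℝ _

theorem convex_openBody : Convex ℝ (openBody T) := (convex_body T).interior

theorem openBody_subset_body : openBody T ⊆ body T := interior_subset

theorem nonempty_openBody : (openBody T).Nonempty := by
  rw [openBody, body, interior_convexHull_nonempty_iff_affineSpan_eq_top]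
  exact T.span_eq_top (by simp)

theorem body_ae_eq_openBody : (body T : Set (Pt d)) =ᵐ[volume] openBody T := by
  have h0 := (convex_body T).addHaar_frontier volume
  have h : body T \ openBody T ⊆ frontier (body T) := fun x hx => ⟨subset_closure hx.1, hx.2⟩
  exact (ae_le_set.2 (measure_mono_null h h0)).antisymm (openBody_subset_body T).eventuallyLE

theorem volume_openBody_ne_top : volume (openBody T) ≠ ∞ :=
  ((measure_mono (openBody_subset_body T)).trans_lt (isCompact_body T).measure_lt_top).ne

theorem volume_openBody_ne_zero : volume (openBody T) ≠ 0 :=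
  ((isOpen_openBody T).measure_pos volume (nonempty_openBody T)).ne'

theorem dist_le_diam_body {x y : Pt d} (hx : x ∈ body T) (hy : y ∈ body T) :
    dist x y ≤ Metric.diam (body T) :=
  Metric.dist_le_diam_of_mem (isCompact_body T).isBounded hx hy

end Element

namespace Mesh

variable {d : ℕ} {Ω : Set (Pt d)} (𝒯 : Mesh Ω)

theorem openBody_subset {T : Affine.Simplex ℝ (Pt d) d} (hT : T ∈ 𝒯.elems) : openBody T ⊆ Ω :=
  𝒯.interior_subset T hT

theorem pairwiseDisjoint_openBody : (𝒯.elems : Set (Affine.Simplex ℝ (Pt d) d)).PairwiseDisjoint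
    openBody := fun T hT T' hT' h => 𝒯.disjoint_interior T hT T' hT' h

/-- The frontier of a convex set is null, so open and closed simplices agree almost everywhere. The
open ones lie in Ω and the closed ones cover it. -/
theorem ae_eq_iUnion : (Ω : Set (Pt d)) =ᵐ[volume] ⋃ T ∈ 𝒯.elems, openBody T := by
  have h1 : (⋃ T ∈ 𝒯.elems, body T : Set (Pt d)) =ᵐ[volume] ⋃ T ∈ 𝒯.elems, openBody T :=
    Filter.EventuallyEq.countable_bUnion (𝒯.elems.countable_toSet)
      fun T _ => body_ae_eq_openBody T
  have h2 : (⋃ T ∈ 𝒯.elems, openBody T) ⊆ Ω := iUnion₂_subset fun T hT => 𝒯.openBody_subset hT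
  have h3 : Ω ⊆ ⋃ T ∈ 𝒯.elems, body T := 𝒯.closure_eq ▸ subset_closure
  exact (h3.eventuallyLE.trans h1.le).antisymm h2.eventuallyLE

theorem lintegral_eq_sum (f : Pt d → ℝ≥0∞) :
    ∫⁻ x in Ω, f x = ∑ T ∈ 𝒯.elems, ∫⁻ x in openBody T, f x := by
  rw [setLIntegral_congr 𝒯.ae_eq_iUnion, lintegral_biUnion_finset 𝒯.pairwiseDisjoint_openBody
    fun T _ => measurableSet_openBody T]

theorem integral_eq_sum {f : Pt d → ℝ} (hf : IntegrableOn f Ω) :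
    ∫ x in Ω, f x = ∑ T ∈ 𝒯.elems, ∫ x in openBody T, f x := by
  rw [setIntegral_congr_set 𝒯.ae_eq_iUnion, integral_biUnion_finset _
    (fun T _ => measurableSet_openBody T) 𝒯.pairwiseDisjoint_openBody
    fun T hT => hf.mono_set (𝒯.openBody_subset hT)]

theorem ae_of_forall_openBody {p : Pt d → Prop}
    (h : ∀ T ∈ 𝒯.elems, ∀ᵐ x ∂volume.restrict (openBody T), p x) :
    ∀ᵐ x ∂volume.restrict Ω, p x := by
  rw [Measure.restrict_congr_set 𝒯.ae_eq_iUnion]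
  exact (ae_restrict_biUnion_finset_iff _ _ _).2 h

theorem diam_le_size {T : Affine.Simplex ℝ (Pt d) d} (hT : T ∈ 𝒯.elems) :
    Metric.diam (body T) ≤ 𝒯.size :=
  le_ciSup (f := fun T : 𝒯.elems => Metric.diam (body T.1)) (finite_range _).bddAbove ⟨T, hT⟩

theorem size_nonneg : 0 ≤ 𝒯.size := Real.iSup_nonneg fun _ => Metric.diam_nonneg

end Mesh

/-! ### Norms in `L²` -/

theorem L2_enorm_sq {α E : Type*} [MeasurableSpace α] {μ : Measure α} [NormedAddCommGroup E]
    (f : Lp E 2 μ) : ‖f‖ₑ ^ 2 = ∫⁻ x, ‖f x‖ₑ ^ 2 ∂μ := by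
  rw [Lp.enorm_def, eLpNorm_eq_lintegral_rpow_enorm_toReal (by norm_num) (by norm_num),
    ← ENNReal.rpow_natCast, ← ENNReal.rpow_mul]
  simp

theorem L2_norm_sq {α E : Type*} [MeasurableSpace α] {μ : Measure α} [NormedAddCommGroup E]
    [InnerProductSpace ℝ E] (f : Lp E 2 μ) : ‖f‖ ^ 2 = ∫ x, ‖f x‖ ^ 2 ∂μ := by
  rw [← real_inner_self_eq_norm_sq, L2.inner_def]
  simp_rw [real_inner_self_eq_norm_sq]

theorem enorm_sq_eq_sum {ι : Type*} [Fintype ι] (x : EuclideanSpace ℝ ι) :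
    ‖x‖ₑ ^ 2 = ∑ k, ‖x k‖ₑ ^ 2 := by
  have h : ∀ y : ℝ, ‖y‖ₑ ^ 2 = ENNReal.ofReal (‖y‖ ^ 2) := fun y => by
    rw [ENNReal.ofReal_pow (norm_nonneg _), ofReal_norm]
  rw [← ofReal_norm, ← ENNReal.ofReal_pow (norm_nonneg _), EuclideanSpace.norm_sq_eq,
    ENNReal.ofReal_sum_of_nonneg fun k _ => sq_nonneg _]
  simp_rw [h]

theorem measurable_coord {d : ℕ} {Ω : Set (Pt d)} {ι : Type} [Fintype ι]
    (f : L2 Ω (EuclideanSpace ℝ ι)) (k : ι) : Measurable fun x => f x k :=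
  (EuclideanSpace.proj (𝕜 := ℝ) k).continuous.measurable.comp (Lp.stronglyMeasurable f).measurable

theorem memLp_coord {d : ℕ} {Ω : Set (Pt d)} {ι : Type} [Fintype ι]
    (f : L2 Ω (EuclideanSpace ℝ ι)) (k : ι) : MemLp (fun x => f x k) 2 (volume.restrict Ω) :=
  (EuclideanSpace.proj (𝕜 := ℝ) k : EuclideanSpace ℝ ι →L[ℝ] ℝ).comp_memLp' (Lp.memLp f)

theorem integrable_coord {d : ℕ} {Ω : Set (Pt d)} (hb : Bornology.IsBounded Ω) {ι : Type}
    [Fintype ι] (f : L2 Ω (EuclideanSpace ℝ ι)) (k : ι) : IntegrableOn (fun x => f x k) Ω :=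
  have : IsFiniteMeasure (volume.restrict Ω) := ⟨by simpa using hb.measure_lt_top⟩
  (memLp_coord f k).integrable (by norm_num)

/-! ### Approximation by piecewise constants -/

/-- The constant is f(x) at a point x where the inner integral of |f(y) − f(x)|² does not exceed its
average over the simplex. The volume from the averaging cancels the one in the double-integral
bound. -/
theorem exists_lintegral_sub_const_sq_le {d : ℕ} {Ω : Set (Pt d)} (hΩ : MeasurableSet Ω)
    {T : Affine.Simplex ℝ (Pt d) d} (hT : openBody T ⊆ Ω) {D : ℝ}
    (hD : Metric.diam (body T) ≤ D) {f : Pt d → ℝ} {G : Fin d → Pt d → ℝ}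
    (hfm : Measurable f) (hGm : ∀ j, Measurable (G j))
    (hf : IntegrableOn f Ω) (hw : ∀ j, HasWeakPartial Ω j f (G j)) :
    ∃ c : ℝ, ∫⁻ x in openBody T, ‖f x - c‖ₑ ^ 2 ≤
      ENNReal.ofReal D ^ 2 * (2 ^ d * ∑ j, ∫⁻ x in openBody T, ‖G j x‖ₑ ^ 2) := by
  have key := lintegral_lintegral_enorm_sub_sq_le_of_hasWeakPartial hΩ (convex_openBody T)
    (isOpen_openBody T) hT (D := ENNReal.ofReal D) (fun x hx y hy => by
      rw [← ofReal_norm, ← dist_eq_norm]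
      exact ENNReal.ofReal_le_ofReal ((dist_le_diam_body T (openBody_subset_body T hy)
        (openBody_subset_body T hx)).trans hD)) hfm hGm hf hw
  have hv0 := volume_openBody_ne_zero T
  have hvt := volume_openBody_ne_top T
  have : IsFiniteMeasure (volume.restrict (openBody T)) := ⟨by simpa using hvt.lt_top⟩
  have hm : Measurable fun x => ∫⁻ y in openBody T, ‖f y - f x‖ₑ ^ 2 :=
    Measurable.lintegral_prod_right' (f := fun p : Pt d × Pt d => ‖f p.2 - f p.1‖ₑ ^ 2)
      (((hfm.comp measurable_snd).sub (hfm.comp measurable_fst)).enorm.pow_const 2)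
  obtain ⟨x, hx⟩ := exists_le_laverage (μ := volume.restrict (openBody T))
    (by simpa using hv0) hm.aemeasurable
  refine ⟨f x, hx.trans ?_⟩
  rw [laverage_eq, Measure.restrict_apply_univ]
  refine ENNReal.div_le_of_le_mul (key.trans (le_of_eq ?_))
  ring

/-- The field with the constant value `c T` on each element `T`. -/
theorem exists_piecewise_const {d : ℕ} {Ω : Set (Pt d)} (𝒯 : Mesh Ω) {E : Type}
    [NormedAddCommGroup E] [NormedSpace ℝ E] (c : Affine.Simplex ℝ (Pt d) d → E) :
    ∃ φ : L2 Ω E, ∀ T ∈ 𝒯.elems, ∀ᵐ x ∂volume.restrict (openBody T), φ x = c T := by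
  have hmem : MemLp (fun x => ∑ T ∈ 𝒯.elems, (openBody T).indicator (fun _ => c T) x) 2
      (volume.restrict Ω) := by
    refine memLp_finsetSum _ fun T hT => ?_
    refine memLp_indicator_const 2 (measurableSet_openBody T) (c T) (Or.inr ?_)
    exact ((Measure.restrict_apply_le _ _).trans_lt (volume_openBody_ne_top T).lt_top).ne
  refine ⟨hmem.toLp _, fun T hT => ?_⟩
  filter_upwards [ae_restrict_of_ae_restrict_of_subset (𝒯.openBody_subset hT) hmem.coeFn_toLp,
    ae_restrict_mem (measurableSet_openBody T)] with x hx hxT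
  rw [hx, Finset.sum_eq_single_of_mem T hT, indicator_of_mem hxT]
  intro T' hT' hne
  exact indicator_of_notMem (fun h =>
    (disjoint_left.1 (𝒯.pairwiseDisjoint_openBody hT' hT hne)) h hxT) _

theorem isPW_zero_of_ae_eq_const {d : ℕ} {Ω : Set (Pt d)} {𝒯 : Mesh Ω} {ι : Type} [Fintype ι]
    {φ : L2 Ω (EuclideanSpace ℝ ι)} {c : Affine.Simplex ℝ (Pt d) d → EuclideanSpace ℝ ι}
    (h : ∀ T ∈ 𝒯.elems, ∀ᵐ x ∂volume.restrict (openBody T), φ x = c T) : IsPW 𝒯 0 φ :=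
  fun T hT => ⟨fun a => MvPolynomial.C (c T a), fun a => by simp, by
    filter_upwards [h T hT] with x hx a
    simp [hx]⟩

theorem exists_isPW_zero_norm_sub_le {d : ℕ} {Ω : Set (Pt d)} (hΩ : IsLipschitzDomain Ω)
    (𝒯 : Mesh Ω) {ι : Type} [Fintype ι] {f : L2 Ω (EuclideanSpace ℝ ι)} {M : ℝ}
    (hf : H1NormLE Ω f M) : ∃ φ, IsPW 𝒯 0 φ ∧ ‖f - φ‖ ≤ 2 ^ d * M * 𝒯.size := by
  obtain ⟨G, hG, hM⟩ := hf
  have hM0 : 0 ≤ M := (Real.sqrt_nonneg _).trans hM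
  have hGM : ‖G‖ ≤ M := (Real.le_sqrt (norm_nonneg _) (by positivity)).2
    (le_add_of_nonneg_left (sq_nonneg _)) |>.trans hM
  have hc : ∀ T : Affine.Simplex ℝ (Pt d) d, ∃ c : EuclideanSpace ℝ ι, T ∈ 𝒯.elems → ∀ k,
      ∫⁻ x in openBody T, ‖f x k - c k‖ₑ ^ 2 ≤ ENNReal.ofReal 𝒯.size ^ 2 *
        (2 ^ d * ∑ j, ∫⁻ x in openBody T, ‖G x (k, j)‖ₑ ^ 2) := fun T => by
    by_cases hT : T ∈ 𝒯.elems
    · choose c hc using fun k => exists_lintegral_sub_const_sq_le hΩ.1.measurableSet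
        (𝒯.openBody_subset hT) (𝒯.diam_le_size hT) (measurable_coord f k)
        (fun j => measurable_coord G (k, j)) (integrable_coord hΩ.2.2.1 f k) (hG k)
      exact ⟨WithLp.toLp 2 c, fun _ k => hc k⟩
    · exact ⟨0, fun h => absurd h hT⟩
  choose c hc using hc
  obtain ⟨φ, hφ⟩ := exists_piecewise_const 𝒯 c
  refine ⟨φ, isPW_zero_of_ae_eq_const hφ, ?_⟩
  have h1 : ‖f - φ‖ₑ ^ 2 ≤ ENNReal.ofReal 𝒯.size ^ 2 * (2 ^ d * ‖G‖ₑ ^ 2) := by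
    rw [L2_enorm_sq, L2_enorm_sq, 𝒯.lintegral_eq_sum, 𝒯.lintegral_eq_sum, Finset.mul_sum,
      Finset.mul_sum]
    refine Finset.sum_le_sum fun T hT => ?_
    have hsub := ae_restrict_of_ae_restrict_of_subset (𝒯.openBody_subset hT) (Lp.coeFn_sub f φ)
    calc ∫⁻ x in openBody T, ‖(f - φ) x‖ₑ ^ 2
        = ∫⁻ x in openBody T, ∑ k, ‖f x k - c T k‖ₑ ^ 2 := by
          refine lintegral_congr_ae ?_
          filter_upwards [hsub, hφ T hT] with x h1 h2
          rw [h1, Pi.sub_apply, h2, enorm_sq_eq_sum]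
          rfl
      _ = ∑ k, ∫⁻ x in openBody T, ‖f x k - c T k‖ₑ ^ 2 :=
          lintegral_finsetSum _ fun k _ => ((measurable_coord f k).sub_const _).enorm.pow_const 2
      _ ≤ ∑ k, ENNReal.ofReal 𝒯.size ^ 2 *
            (2 ^ d * ∑ j, ∫⁻ x in openBody T, ‖G x (k, j)‖ₑ ^ 2) :=
          Finset.sum_le_sum fun k _ => hc T hT k
      _ = ENNReal.ofReal 𝒯.size ^ 2 * (2 ^ d * ∫⁻ x in openBody T, ‖G x‖ₑ ^ 2) := by
          simp_rw [enorm_sq_eq_sum]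
          rw [lintegral_finsetSum _ fun p _ => (measurable_coord G p).enorm.pow_const 2,
            Fintype.sum_prod_type, Finset.mul_sum, Finset.mul_sum]
  have h2 : ENNReal.ofReal (‖f - φ‖ ^ 2) ≤ ENNReal.ofReal ((2 ^ d * M * 𝒯.size) ^ 2) := by
    have hs := 𝒯.size_nonneg
    rw [ENNReal.ofReal_pow (norm_nonneg _), ofReal_norm]
    refine h1.trans ?_
    have : ENNReal.ofReal 𝒯.size ^ 2 * (2 ^ d * ‖G‖ₑ ^ 2) =
        ENNReal.ofReal (𝒯.size ^ 2 * (2 ^ d * ‖G‖ ^ 2)) := by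
      rw [ENNReal.ofReal_mul (by positivity), ENNReal.ofReal_mul (by positivity),
        ENNReal.ofReal_pow hs, ENNReal.ofReal_pow (norm_nonneg _), ofReal_norm,
        ENNReal.ofReal_pow (by norm_num)]
      norm_num
    rw [this]
    refine ENNReal.ofReal_le_ofReal ?_
    -- The squared estimate has the factor 2^d; enlarging it to (2^d)² avoids a square root in the
    -- final constant.
    have h2d : (1 : ℝ) ≤ 2 ^ d := one_le_pow₀ (by norm_num)
    calc 𝒯.size ^ 2 * (2 ^ d * ‖G‖ ^ 2) ≤ 𝒯.size ^ 2 * ((2 ^ d) ^ 2 * M ^ 2) := by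
          gcongr
          exact le_self_pow₀ h2d (by norm_num)
      _ = _ := by ring
  rw [ENNReal.ofReal_le_ofReal_iff (sq_nonneg _)] at h2
  exact (sq_le_sq₀ (norm_nonneg _) (by have := 𝒯.size_nonneg; positivity)).1 h2

/-! ### Quadratic polynomials on shape-regular elements -/

/-- The value of a polynomial at a point. -/
def polyVal {d : ℕ} (p : MvPolynomial (Fin d) ℝ) (x : Pt d) : ℝ :=
  MvPolynomial.eval (fun j => x j) p

theorem continuous_polyVal {d : ℕ} (p : MvPolynomial (Fin d) ℝ) : Continuous (polyVal p) :=
  p.continuous_eval.comp (by fun_prop)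

/-- By continuity the polynomial vanishes on all of U, hence on a cube, a product of infinite sets.
-/
theorem eq_zero_of_polyVal_ae_eq_zero {d : ℕ} {U : Set (Pt d)} (hU : IsOpen U) (hne : U.Nonempty)
    {p : MvPolynomial (Fin d) ℝ} (h : ∀ᵐ x ∂volume.restrict U, polyVal p x = 0) : p = 0 := by
  have h0 : EqOn (polyVal p) (fun _ => 0) U := Measure.eqOn_open_of_ae_eq h hU
    (continuous_polyVal p).continuousOn continuousOn_const
  obtain ⟨x, hx⟩ := hne
  have hpre : IsOpen ((WithLp.toLp 2 : (Fin d → ℝ) → Pt d) ⁻¹' U) :=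
    hU.preimage (PiLp.continuous_toLp 2 _)
  obtain ⟨ε, hε, hb⟩ := Metric.isOpen_iff.1 hpre (x : Fin d → ℝ) (by simpa using hx)
  refine MvPolynomial.funext_set (fun j => Metric.ball (x j) ε)
    (fun j => infinite_of_mem_nhds (x j) (Metric.ball_mem_nhds _ hε)) fun y hy => ?_
  have hy' : y ∈ Metric.ball (x : Fin d → ℝ) ε := by
    rw [ball_pi _ hε]
    exact hy
  simpa [polyVal] using h0 (hb hy')

/-- Composition of a polynomial with a homothety. -/
def rescale {d : ℕ} (c : Pt d) (r : ℝ) (p : MvPolynomial (Fin d) ℝ) : MvPolynomial (Fin d) ℝ :=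
  MvPolynomial.bind₁ (fun j => MvPolynomial.C (c j) + MvPolynomial.C r * MvPolynomial.X j) p

theorem polyVal_rescale {d : ℕ} (c : Pt d) (r : ℝ) (p : MvPolynomial (Fin d) ℝ) (z : Pt d) :
    polyVal (rescale c r p) z = polyVal p (c + r • z) := by
  rw [polyVal, rescale, MvPolynomial.eval, MvPolynomial.eval₂Hom_bind₁]
  have : (fun j => MvPolynomial.eval₂Hom (RingHom.id ℝ) (fun j => z j)
      (MvPolynomial.C (c j) + MvPolynomial.C r * MvPolynomial.X j)) = fun j => (c + r • z) j := by
    ext j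
    simp
  rw [this]
  rfl

theorem totalDegree_rescale_le {d : ℕ} (c : Pt d) (r : ℝ) (p : MvPolynomial (Fin d) ℝ) :
    (rescale c r p).totalDegree ≤ p.totalDegree := by
  have hlin : ∀ j : Fin d, (MvPolynomial.C (c j) + MvPolynomial.C r * MvPolynomial.X j :
      MvPolynomial (Fin d) ℝ).totalDegree ≤ 1 := fun j => by
    refine (MvPolynomial.totalDegree_add _ _).trans (max_le (by simp) ?_)
    refine (MvPolynomial.totalDegree_mul _ _).trans ?_
    simp
  rw [rescale, MvPolynomial.bind₁, MvPolynomial.aeval_def, MvPolynomial.eval₂_eq]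
  refine MvPolynomial.totalDegree_finsetSum_le fun m hm => ?_
  refine (MvPolynomial.totalDegree_mul _ _).trans ?_
  rw [MvPolynomial.algebraMap_eq, MvPolynomial.totalDegree_C, zero_add]
  refine (MvPolynomial.totalDegree_finsetProd _ _).trans ?_
  refine le_trans ?_ (MvPolynomial.le_totalDegree hm)
  refine Finset.sum_le_sum fun j _ => (MvPolynomial.totalDegree_pow _ _).trans ?_
  exact (Nat.mul_le_mul_left (m j) (hlin j)).trans (mul_one _).le

theorem memLp_polyVal {d : ℕ} {K : Set (Pt d)} (hK : IsCompact K) (p : MvPolynomial (Fin d) ℝ) :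
    MemLp (polyVal p) 2 (volume.restrict K) := by
  have : IsFiniteMeasure (volume.restrict K) := ⟨by simpa using hK.measure_lt_top⟩
  obtain ⟨C, hC⟩ := hK.exists_bound_of_continuousOn (continuous_polyVal p).continuousOn
  exact MemLp.of_bound (continuous_polyVal p).aestronglyMeasurable C
    ((ae_restrict_iff' hK.measurableSet).2 (Filter.Eventually.of_forall hC))

/-- On the unit ball the `L²` norm of a quadratic polynomial controls its values on any ball. -/
theorem exists_sq_polyVal_le_unit (d : ℕ) (R : ℝ) : ∃ C, 0 ≤ C ∧
    ∀ p : MvPolynomial (Fin d) ℝ, p.totalDegree ≤ 2 → ∀ z ∈ Metric.closedBall (0 : Pt d) R,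
      polyVal p z ^ 2 ≤ C * ∫ x in Metric.closedBall (0 : Pt d) 1, polyVal p x ^ 2 := by
  let V := MvPolynomial.restrictTotalDegree (Fin d) ℝ 2
  let B := Metric.closedBall (0 : Pt d) 1
  have hB : IsCompact B := isCompact_closedBall _ _
  let J : V →ₗ[ℝ] Lp ℝ 2 (volume.restrict B) :=
    { toFun := fun p => (memLp_polyVal hB p.1).toLp _
      map_add' := fun p q => by
        rw [← MemLp.toLp_add]
        congr 1
        ext x
        simp [polyVal]
      map_smul' := fun a p => by
        rw [RingHom.id_apply, ← MemLp.toLp_const_smul]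
        congr 1
        ext x
        simp [polyVal, MvPolynomial.smul_eval] }
  have hJ : Function.Injective J := by
    refine (injective_iff_map_eq_zero J).2 fun p hp => ?_
    have h0 : ∀ᵐ x ∂volume.restrict B, polyVal p.1 x = 0 := by
      have h1 : (J p : Pt d → ℝ) =ᵐ[volume.restrict B] polyVal p.1 :=
        MemLp.coeFn_toLp (memLp_polyVal hB p.1)
      have h2 := Lp.coeFn_zero ℝ 2 (volume.restrict B)
      rw [hp] at h1
      filter_upwards [h1, h2] with x h1 h2
      rw [← h1, h2, Pi.zero_apply]
    refine Subtype.ext (eq_zero_of_polyVal_ae_eq_zero (Metric.isOpen_ball (x := (0 : Pt d)) (ε := 1))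
      ⟨0, by simp⟩ ?_)
    exact ae_restrict_of_ae_restrict_of_subset Metric.ball_subset_closedBall h0
  have : CompactSpace (Metric.closedBall (0 : Pt d) R) :=
    isCompact_iff_compactSpace.1 (isCompact_closedBall _ _)
  let E : V →ₗ[ℝ] C(Metric.closedBall (0 : Pt d) R, ℝ) :=
    { toFun := fun p => ⟨fun z => polyVal p.1 z, (continuous_polyVal p.1).comp continuous_subtype_val⟩
      map_add' := fun p q => by ext z; simp [polyVal]
      map_smul' := fun a p => by ext z; simp [polyVal, MvPolynomial.smul_eval] }
  let e := LinearEquiv.ofInjective J hJ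
  -- `J` embeds the quadratics into L² of the unit ball. Linear maps out of its finite-dimensional
  -- range are continuous, so recovering the values on the ball of radius R is a bounded operation.
  let F : LinearMap.range J →L[ℝ] C(Metric.closedBall (0 : Pt d) R, ℝ) :=
    LinearMap.toContinuousLinearMap (E ∘ₗ e.symm.toLinearMap)
  refine ⟨‖F‖ ^ 2, sq_nonneg _, fun p hp z hz => ?_⟩
  let q : V := ⟨p, (MvPolynomial.mem_restrictTotalDegree _ _ _).2 hp⟩
  have h1 : ‖E q‖ ≤ ‖F‖ * ‖J q‖ := by
    have := F.le_opNorm (e q)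
    simpa [F, e] using this
  have h2 : |polyVal p z| ≤ ‖E q‖ := (E q).norm_coe_le_norm ⟨z, hz⟩
  have h3 : ‖J q‖ ^ 2 = ∫ x in B, polyVal p x ^ 2 := by
    rw [L2_norm_sq]
    refine integral_congr_ae ?_
    filter_upwards [MemLp.coeFn_toLp (memLp_polyVal hB p)] with x hx
    change ‖(MemLp.toLp (polyVal p) (memLp_polyVal hB p) : Pt d → ℝ) x‖ ^ 2 = _
    rw [hx, Real.norm_eq_abs, sq_abs]
  calc polyVal p z ^ 2 = |polyVal p z| ^ 2 := (sq_abs _).symm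
    _ ≤ (‖F‖ * ‖J q‖) ^ 2 := by gcongr; exact h2.trans h1
    _ = _ := by rw [mul_pow, h3]

theorem integral_closedBall_homothety {d : ℕ} (c : Pt d) {r : ℝ} (hr : 0 < r) (F : Pt d → ℝ) :
    ∫ z in Metric.closedBall (0 : Pt d) 1, F (c + r • z) =
      (r ^ d)⁻¹ * ∫ x in Metric.closedBall c r, F x := by
  have h1 : ∀ z : Pt d, (Metric.closedBall (0 : Pt d) 1).indicator (fun z => F (c + r • z)) z =
      (Metric.closedBall c r).indicator F (c + r • z) := fun z => by
    have : z ∈ Metric.closedBall (0 : Pt d) 1 ↔ c + r • z ∈ Metric.closedBall c r := by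
      rw [mem_closedBall_zero_iff, mem_closedBall_iff_norm, add_sub_cancel_left, norm_smul,
        Real.norm_of_nonneg hr.le, mul_le_iff_le_one_right hr]
    by_cases hz : z ∈ Metric.closedBall (0 : Pt d) 1
    · rw [indicator_of_mem hz, indicator_of_mem (this.1 hz)]
    · rw [indicator_of_notMem hz, indicator_of_notMem fun h => hz (this.2 h)]
  rw [← integral_indicator measurableSet_closedBall, ← integral_indicator measurableSet_closedBall]
  simp_rw [h1]
  rw [Measure.integral_comp_smul volume (fun x => (Metric.closedBall c r).indicator F (c + x)) r,
    integral_add_left_eq_self (fun x => (Metric.closedBall c r).indicator F x) c]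
  simp [abs_of_pos hr]

/-- On shape-regular elements, point values of quadratic polynomials are controlled by the `L²`
norm. -/
theorem exists_volume_mul_sq_polyVal_le (d : ℕ) (ρ : ℝ) : ∃ C, 0 ≤ C ∧
    ∀ (T : Affine.Simplex ℝ (Pt d) d), (∃ x : Pt d, ∃ r > 0,
      Metric.closedBall x r ⊆ body T ∧ Metric.diam (body T) ≤ ρ * r) →
    ∀ p : MvPolynomial (Fin d) ℝ, p.totalDegree ≤ 2 → ∀ y ∈ body T,
      volume.real (body T) * polyVal p y ^ 2 ≤ C * ∫ x in openBody T, polyVal p x ^ 2 := by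
  obtain ⟨C, hC, hCp⟩ := exists_sq_polyVal_le_unit d ρ
  set v := volume.real (Metric.ball (0 : Pt d) 1)
  -- The volume of T is at most (ρr)^d times that of the unit ball, and this r^d cancels the r^(-d)
  -- produced by rescaling the inscribed ball. The absolute value only matters for negative ρ, which
  -- no element can satisfy.
  refine ⟨|ρ| ^ d * v * C, by positivity, ?_⟩
  rintro T ⟨c, r, hr, hcT, hdiam⟩ p hp y hy
  have hcb : c ∈ body T := hcT (Metric.mem_closedBall_self hr.le)
  have hρr : 0 ≤ ρ * r := Metric.diam_nonneg.trans hdiam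
  have hρ : 0 ≤ ρ := nonneg_of_mul_nonneg_left hρr hr
  have hTb : body T ⊆ Metric.closedBall c (ρ * r) := fun x hx =>
    (dist_le_diam_body T hx hcb).trans hdiam
  have hvol : volume.real (body T) ≤ (ρ * r) ^ d * v := by
    refine (measureReal_mono hTb measure_closedBall_lt_top.ne).trans (le_of_eq ?_)
    rw [Measure.addHaar_real_closedBall _ _ hρr, finrank_euclideanSpace, Fintype.card_fin]
  have hz : r⁻¹ • (y - c) ∈ Metric.closedBall (0 : Pt d) ρ := by
    rw [mem_closedBall_zero_iff, norm_smul, Real.norm_of_nonneg (by positivity), ← dist_eq_norm,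
      inv_mul_le_iff₀ hr, mul_comm]
    exact hTb hy
  have h1 := hCp (rescale c r p) ((totalDegree_rescale_le c r p).trans hp) _ hz
  simp_rw [polyVal_rescale] at h1
  rw [smul_inv_smul₀ hr.ne', add_sub_cancel,
    integral_closedBall_homothety c hr fun x => polyVal p x ^ 2] at h1
  have h2 : ∫ x in Metric.closedBall c r, polyVal p x ^ 2 ≤ ∫ x in openBody T, polyVal p x ^ 2 := by
    rw [← setIntegral_congr_set (body_ae_eq_openBody T)]
    refine setIntegral_mono_set ?_ (Filter.Eventually.of_forall fun x => sq_nonneg _)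
      hcT.eventuallyLE
    exact ((continuous_polyVal p).pow 2).continuousOn.integrableOn_compact (isCompact_body T)
  calc volume.real (body T) * polyVal p y ^ 2
      ≤ ((ρ * r) ^ d * v) * (C * ((r ^ d)⁻¹ * ∫ x in openBody T, polyVal p x ^ 2)) := by
        refine mul_le_mul hvol (h1.trans ?_) (sq_nonneg _) (by positivity)
        gcongr
    _ = _ := by
        rw [abs_of_nonneg hρ, mul_pow]
        field_simp

/-! ### Piecewise polynomials -/

section Piecewise

variable {d : ℕ} {Ω : Set (Pt d)} {ι : Type} [Fintype ι] {T : Affine.Simplex ℝ (Pt d) d}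
  {𝒯 : Mesh Ω} {k : ℕ}

theorem IsPolyOn.ae_eq {f : L2 Ω (EuclideanSpace ℝ ι)} {p : ι → MvPolynomial (Fin d) ℝ}
    (h : IsPolyOn k T f p) : ∀ᵐ x ∂volume.restrict (openBody T), ∀ a, f x a = polyVal (p a) x :=
  h.2

/-- Uniqueness makes the choice in `elemPoly` immaterial; the linearity of `elemPoly` and `elemVal`
on piecewise quadratics follows from it. -/
theorem IsPolyOn.unique {m : ℕ} {f : L2 Ω (EuclideanSpace ℝ ι)}
    {p q : ι → MvPolynomial (Fin d) ℝ} (hp : IsPolyOn k T f p) (hq : IsPolyOn m T f q) :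
    p = q := by
  ext1 a
  refine sub_eq_zero.1 (eq_zero_of_polyVal_ae_eq_zero (isOpen_openBody T) (nonempty_openBody T) ?_)
  filter_upwards [hp.ae_eq, hq.ae_eq] with x h1 h2
  have := (h1 a).symm.trans (h2 a)
  simpa [polyVal, sub_eq_zero] using this

theorem elemPoly_eq {f : L2 Ω (EuclideanSpace ℝ ι)} {p : ι → MvPolynomial (Fin d) ℝ}
    (h : IsPolyOn 2 T f p) : elemPoly T f = p := by
  have hex : ∃ p, IsPolyOn 2 T f p := ⟨p, h⟩
  rw [elemPoly, dif_pos hex]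
  exact hex.choose_spec.unique h

theorem IsPW.isPolyOn_elemPoly {f : L2 Ω (EuclideanSpace ℝ ι)} (hf : IsPW 𝒯 2 f)
    (hT : T ∈ 𝒯.elems) : IsPolyOn 2 T f (elemPoly T f) := by
  obtain ⟨p, hp⟩ := hf T hT
  rwa [elemPoly_eq hp]

theorem IsPW.mono {m : ℕ} (hkm : k ≤ m) {f : L2 Ω (EuclideanSpace ℝ ι)} (hf : IsPW 𝒯 k f) :
    IsPW 𝒯 m f := fun T hT => by
  obtain ⟨p, hp⟩ := hf T hT
  exact ⟨p, fun a => (hp.1 a).trans hkm, hp.2⟩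

theorem IsPolyOn.add (hT : openBody T ⊆ Ω) {f g : L2 Ω (EuclideanSpace ℝ ι)}
    {p q : ι → MvPolynomial (Fin d) ℝ} (hf : IsPolyOn k T f p) (hg : IsPolyOn k T g q) :
    IsPolyOn k T (f + g) (p + q) := by
  refine ⟨fun a => (MvPolynomial.totalDegree_add _ _).trans (max_le (hf.1 a) (hg.1 a)), ?_⟩
  filter_upwards [hf.2, hg.2,
    ae_restrict_of_ae_restrict_of_subset hT (Lp.coeFn_add f g)] with x h1 h2 h3 a
  rw [h3, Pi.add_apply, PiLp.add_apply, h1 a, h2 a, Pi.add_apply, map_add]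

theorem IsPolyOn.smul (hT : openBody T ⊆ Ω) {f : L2 Ω (EuclideanSpace ℝ ι)}
    {p : ι → MvPolynomial (Fin d) ℝ} (c : ℝ) (hf : IsPolyOn k T f p) :
    IsPolyOn k T (c • f) (c • p) := by
  refine ⟨fun a => (MvPolynomial.totalDegree_smul_le _ _).trans (hf.1 a), ?_⟩
  filter_upwards [hf.2, ae_restrict_of_ae_restrict_of_subset hT (Lp.coeFn_smul c f)] with x h1 h3 a
  simp [h3, h1 a, MvPolynomial.smul_eval]

variable (𝒯 k) in
/-- The piecewise polynomials of degree at most `k`, as a subspace. -/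
def pwSubmodule (ι : Type) [Fintype ι] : Submodule ℝ (L2 Ω (EuclideanSpace ℝ ι)) where
  carrier := {f | IsPW 𝒯 k f}
  zero_mem' := fun T hT => ⟨0, by simp, by
    filter_upwards [ae_restrict_of_ae_restrict_of_subset (𝒯.openBody_subset hT)
      (Lp.coeFn_zero (EuclideanSpace ℝ ι) 2 (volume.restrict Ω))] with x hx a
    rw [hx]
    simp⟩
  add_mem' := fun hf hg T hT => by
    obtain ⟨p, hp⟩ := hf T hT
    obtain ⟨q, hq⟩ := hg T hT
    exact ⟨_, hp.add (𝒯.openBody_subset hT) hq⟩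
  smul_mem' := fun c f hf T hT => by
    obtain ⟨p, hp⟩ := hf T hT
    exact ⟨_, hp.smul (𝒯.openBody_subset hT) c⟩

theorem elemPoly_add {f g : L2 Ω (EuclideanSpace ℝ ι)} (hf : IsPW 𝒯 2 f) (hg : IsPW 𝒯 2 g)
    (hT : T ∈ 𝒯.elems) : elemPoly T (f + g) = elemPoly T f + elemPoly T g :=
  elemPoly_eq ((hf.isPolyOn_elemPoly hT).add (𝒯.openBody_subset hT) (hg.isPolyOn_elemPoly hT))

theorem elemPoly_smul {f : L2 Ω (EuclideanSpace ℝ ι)} (hf : IsPW 𝒯 2 f) (c : ℝ)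
    (hT : T ∈ 𝒯.elems) : elemPoly T (c • f) = c • elemPoly T f :=
  elemPoly_eq ((hf.isPolyOn_elemPoly hT).smul (𝒯.openBody_subset hT) c)

theorem elemVal_add {f g : L2 Ω (EuclideanSpace ℝ ι)} (hf : IsPW 𝒯 2 f) (hg : IsPW 𝒯 2 g)
    (hT : T ∈ 𝒯.elems) (x : Pt d) : elemVal T (f + g) x = elemVal T f x + elemVal T g x := by
  ext a
  simp [elemVal, elemPoly_add hf hg hT]

theorem elemVal_smul {f : L2 Ω (EuclideanSpace ℝ ι)} (hf : IsPW 𝒯 2 f) (c : ℝ)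
    (hT : T ∈ 𝒯.elems) (x : Pt d) : elemVal T (c • f) x = c • elemVal T f x := by
  ext a
  simp [elemVal, elemPoly_smul hf c hT, MvPolynomial.smul_eval]

theorem elemVal_eq_of_ae_eq_const {f : L2 Ω (EuclideanSpace ℝ ι)} {c : EuclideanSpace ℝ ι}
    (h : ∀ᵐ x ∂volume.restrict (openBody T), f x = c) (x : Pt d) : elemVal T f x = c := by
  have : elemPoly T f = fun a => MvPolynomial.C (c a) := elemPoly_eq
    ⟨fun a => by simp, by filter_upwards [h] with x hx a; simp [hx]⟩
  ext a
  simp [elemVal, this]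

theorem IsPW.exists_ae_eq_const {f : L2 Ω (EuclideanSpace ℝ ι)} (hf : IsPW 𝒯 0 f)
    (hT : T ∈ 𝒯.elems) :
    ∃ c : EuclideanSpace ℝ ι, ∀ᵐ x ∂volume.restrict (openBody T), f x = c := by
  obtain ⟨p, hp⟩ := hf T hT
  refine ⟨WithLp.toLp 2 fun a => (p a).coeff 0, ?_⟩
  filter_upwards [hp.2] with x hx
  ext a
  rw [hx a, MvPolynomial.totalDegree_eq_zero_iff_eq_C.1 (Nat.le_zero.1 (hp.1 a))]
  simp

/-- A piecewise quadratic is determined almost everywhere by its finitely many element polynomials.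
-/
theorem finiteDimensional_pwSubmodule : FiniteDimensional ℝ (pwSubmodule 𝒯 2 ι) := by
  let V := MvPolynomial.restrictTotalDegree (Fin d) ℝ 2
  let J : pwSubmodule 𝒯 2 ι →ₗ[ℝ] (𝒯.elems → ι → V) :=
    { toFun := fun f T a => ⟨elemPoly T.1 f.1 a,
        (MvPolynomial.mem_restrictTotalDegree _ _ _).2 ((f.2.isPolyOn_elemPoly T.2).1 a)⟩
      map_add' := fun f g => by
        ext1 T; ext1 a
        exact Subtype.ext (congrFun (elemPoly_add f.2 g.2 T.2) a)
      map_smul' := fun c f => by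
        ext1 T; ext1 a
        exact Subtype.ext (congrFun (elemPoly_smul f.2 c T.2) a) }
  refine Module.Finite.of_injective J ((injective_iff_map_eq_zero J).2 fun f hf => ?_)
  refine Subtype.ext (Lp.ext ?_)
  refine Filter.EventuallyEq.trans ?_ (Lp.coeFn_zero _ _ _).symm
  refine 𝒯.ae_of_forall_openBody fun T hT => ?_
  filter_upwards [(f.2.isPolyOn_elemPoly hT).ae_eq] with x hx
  ext a
  have : elemPoly T f.1 a = 0 := congrArg Subtype.val (congrFun (congrFun hf ⟨T, hT⟩) a)
  rw [hx a, this]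
  simp [polyVal]

end Piecewise

/-! ### Quadrature forms -/

theorem QuadRule.pt_mem_body {d : ℕ} {κ : Type} (Q : QuadRule d κ)
    (T : Affine.Simplex ℝ (Pt d) d) 
    (q : κ) : Q.pt T q ∈ body T :=
  (convex_body T).sum_mem (fun j _ => (Q.node_mem q).1 j) (Q.node_mem q).2
    fun j _ => subset_convexHull ℝ _ (mem_range_self j)

section Form

variable {d : ℕ} {Ω : Set (Pt d)} {ι : Type} [Fintype ι] {𝒯 : Mesh Ω} {κ : Type} [Fintype κ]
  (Q : QuadRule d κ)

theorem QuadRule.form_comm_id (φ ψ : L2 Ω (EuclideanSpace ℝ ι)) :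
    Q.form 𝒯 id φ ψ = Q.form 𝒯 id ψ φ := by
  simp only [QuadRule.form, id, real_inner_comm]

theorem QuadRule.form_self_nonneg (φ : L2 Ω (EuclideanSpace ℝ ι)) : 0 ≤ Q.form 𝒯 id φ φ :=
  Finset.sum_nonneg fun _ _ => mul_nonneg measureReal_nonneg
    (Finset.sum_nonneg fun _ _ => mul_nonneg (Q.weight_nonneg _) real_inner_self_nonneg)

variable {Q}

theorem QuadRule.form_add_left (F : EuclideanSpace ℝ ι →L[ℝ] EuclideanSpace ℝ ι)
    {φ φ' : L2 Ω (EuclideanSpace ℝ ι)} (h : IsPW 𝒯 2 φ) (h' : IsPW 𝒯 2 φ')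
    (ψ : L2 Ω (EuclideanSpace ℝ ι)) :
    Q.form 𝒯 F (φ + φ') ψ = Q.form 𝒯 F φ ψ + Q.form 𝒯 F φ' ψ := by
  rw [QuadRule.form, QuadRule.form, QuadRule.form, ← Finset.sum_add_distrib]
  refine Finset.sum_congr rfl fun T hT => ?_
  rw [← mul_add, ← Finset.sum_add_distrib]
  simp only [elemVal_add h h' hT, map_add, inner_add_left, mul_add]

theorem QuadRule.form_smul_left (F : EuclideanSpace ℝ ι →L[ℝ] EuclideanSpace ℝ ι)
    {φ : L2 Ω (EuclideanSpace ℝ ι)} (h : IsPW 𝒯 2 φ) (c : ℝ) (ψ : L2 Ω (EuclideanSpace ℝ ι)) :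
    Q.form 𝒯 F (c • φ) ψ = c * Q.form 𝒯 F φ ψ := by
  rw [QuadRule.form, QuadRule.form, Finset.mul_sum]
  refine Finset.sum_congr rfl fun T hT => ?_
  simp only [elemVal_smul h c hT, map_smul, real_inner_smul_left]
  simp_rw [mul_left_comm _ c, ← Finset.mul_sum]
  rw [mul_left_comm]

theorem QuadRule.form_add_right (F : EuclideanSpace ℝ ι → EuclideanSpace ℝ ι)
    {ψ ψ' : L2 Ω (EuclideanSpace ℝ ι)} (h : IsPW 𝒯 2 ψ) (h' : IsPW 𝒯 2 ψ')
    (φ : L2 Ω (EuclideanSpace ℝ ι)) :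
    Q.form 𝒯 F φ (ψ + ψ') = Q.form 𝒯 F φ ψ + Q.form 𝒯 F φ ψ' := by
  rw [QuadRule.form, QuadRule.form, QuadRule.form, ← Finset.sum_add_distrib]
  refine Finset.sum_congr rfl fun T hT => ?_
  rw [← mul_add, ← Finset.sum_add_distrib]
  simp only [elemVal_add h h' hT, inner_add_right, mul_add]

theorem QuadRule.form_smul_right (F : EuclideanSpace ℝ ι → EuclideanSpace ℝ ι)
    {ψ : L2 Ω (EuclideanSpace ℝ ι)} (h : IsPW 𝒯 2 ψ) (c : ℝ) (φ : L2 Ω (EuclideanSpace ℝ ι)) :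
    Q.form 𝒯 F φ (c • ψ) = c * Q.form 𝒯 F φ ψ := by
  rw [QuadRule.form, QuadRule.form, Finset.mul_sum]
  refine Finset.sum_congr rfl fun T hT => ?_
  simp only [elemVal_smul h c hT, real_inner_smul_right]
  simp_rw [mul_left_comm _ c, ← Finset.mul_sum]
  rw [mul_left_comm]

theorem QuadRule.mul_form_id_le {F : EuclideanSpace ℝ ι → EuclideanSpace ℝ ι} {α : ℝ}
    (hF : ∀ τ, α * ‖τ‖ ^ 2 ≤ inner ℝ (F τ) τ) (φ : L2 Ω (EuclideanSpace ℝ ι)) :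
    α * Q.form 𝒯 id φ φ ≤ Q.form 𝒯 F φ φ := by
  rw [QuadRule.form, QuadRule.form, Finset.mul_sum]
  refine Finset.sum_le_sum fun T _ => ?_
  rw [mul_left_comm, Finset.mul_sum]
  refine mul_le_mul_of_nonneg_left (Finset.sum_le_sum fun q _ => ?_) measureReal_nonneg
  rw [mul_left_comm]
  refine mul_le_mul_of_nonneg_left ?_ (Q.weight_nonneg q)
  rw [id, real_inner_self_eq_norm_sq]
  exact hF _

/-- Cauchy–Schwarz for one sum over all pairs of an element and a node. The weights |T| w_q are
non-negative, so each splits into two square roots. -/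
theorem QuadRule.abs_form_le (F : EuclideanSpace ℝ ι →L[ℝ] EuclideanSpace ℝ ι)
    (φ ψ : L2 Ω (EuclideanSpace ℝ ι)) :
    |Q.form 𝒯 F φ ψ| ≤ ‖F‖ * (√(Q.form 𝒯 id φ φ) * √(Q.form 𝒯 id ψ ψ)) := by
  let s := 𝒯.elems ×ˢ (Finset.univ : Finset κ)
  let W : Affine.Simplex ℝ (Pt d) d × κ → ℝ := fun p => volume.real (body p.1) * Q.weight p.2
  have hW : ∀ p, 0 ≤ W p := fun p => mul_nonneg measureReal_nonneg (Q.weight_nonneg _)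
  let ev : L2 Ω (EuclideanSpace ℝ ι) → Affine.Simplex ℝ (Pt d) d × κ → EuclideanSpace ℝ ι :=
    fun φ p => elemVal p.1 φ (Q.pt p.1 p.2)
  have hform : ∀ (F : EuclideanSpace ℝ ι → EuclideanSpace ℝ ι) (φ ψ), Q.form 𝒯 F φ ψ =
      ∑ p ∈ s, W p * inner ℝ (F (ev φ p)) (ev ψ p) := fun F φ ψ => by
    rw [Finset.sum_product, QuadRule.form]
    simp only [Finset.mul_sum, W, ev, mul_assoc]
  have hsq : ∀ φ, Q.form 𝒯 id φ φ = ∑ p ∈ s, (√(W p) * ‖ev φ p‖) ^ 2 := fun φ => by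
    rw [hform]
    refine Finset.sum_congr rfl fun p _ => ?_
    rw [id, real_inner_self_eq_norm_sq, mul_pow, Real.sq_sqrt (hW p)]
  rw [hform, hsq, hsq]
  calc |∑ p ∈ s, W p * inner ℝ (F (ev φ p)) (ev ψ p)|
      ≤ ∑ p ∈ s, ‖F‖ * ((√(W p) * ‖ev φ p‖) * (√(W p) * ‖ev ψ p‖)) := by
        refine (Finset.abs_sum_le_sum_abs _ _).trans (Finset.sum_le_sum fun p _ => ?_)
        rw [abs_mul, abs_of_nonneg (hW p)]
        calc W p * |inner ℝ (F (ev φ p)) (ev ψ p)| ≤ W p * (‖F‖ * ‖ev φ p‖ * ‖ev ψ p‖) := by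
              refine mul_le_mul_of_nonneg_left ((abs_real_inner_le_norm _ _).trans ?_) (hW p)
              gcongr
              exact F.le_opNorm _
          _ = _ := by
              rw [mul_mul_mul_comm (√(W p)), Real.mul_self_sqrt (hW p)]
              ring
    _ = ‖F‖ * ∑ p ∈ s, (√(W p) * ‖ev φ p‖) * (√(W p) * ‖ev ψ p‖) := by rw [Finset.mul_sum]
    _ ≤ _ := by
        gcongr
        exact Real.sum_mul_le_sqrt_mul_sqrt _ _ _

variable (Q) in
/-- On shape-regular meshes, the quadrature norm of piecewise quadratic fields is bounded by the
`L²` norm. -/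
theorem QuadRule.exists_form_id_le (ρ : ℝ) : ∃ C, 0 ≤ C ∧
    ∀ {Ω : Set (Pt d)} (𝒯 : Mesh Ω), 𝒯.ShapeRegular ρ → ∀ {ι : Type} [Fintype ι]
      (φ : L2 Ω (EuclideanSpace ℝ ι)), IsPW 𝒯 2 φ → Q.form 𝒯 id φ φ ≤ C * ‖φ‖ ^ 2 := by
  obtain ⟨C, hC, hCp⟩ := exists_volume_mul_sq_polyVal_le d ρ
  have hw : 0 ≤ ∑ q, Q.weight q := Finset.sum_nonneg fun q _ => Q.weight_nonneg q
  refine ⟨(∑ q, Q.weight q) * C, mul_nonneg hw hC, fun {Ω} 𝒯 hρ {ι} _ φ hφ => ?_⟩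
  rw [L2_norm_sq, 𝒯.integral_eq_sum ((Lp.memLp φ).integrable_norm_pow (by norm_num)),
    QuadRule.form, Finset.mul_sum]
  refine Finset.sum_le_sum fun T hT => ?_
  have hpoly := hφ.isPolyOn_elemPoly hT
  have hint : ∑ a, ∫ x in openBody T, polyVal (elemPoly T φ a) x ^ 2 =
      ∫ x in openBody T, ‖φ x‖ ^ 2 := by
    rw [← integral_finsetSum]
    · refine integral_congr_ae ?_
      filter_upwards [hpoly.ae_eq] with x hx
      rw [EuclideanSpace.norm_sq_eq]
      simp [hx]
    · intro a _
      exact (((continuous_polyVal _).pow 2).continuousOn.integrableOn_compact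
        (isCompact_body T)).mono_set (openBody_subset_body T)
  have hval : ∀ y ∈ body T, volume.real (body T) * ‖elemVal T φ y‖ ^ 2 ≤
      C * ∫ x in openBody T, ‖φ x‖ ^ 2 := fun y hy => by
    rw [EuclideanSpace.norm_sq_eq, ← hint, Finset.mul_sum, Finset.mul_sum]
    refine Finset.sum_le_sum fun a _ => ?_
    rw [Real.norm_eq_abs, sq_abs]
    exact hCp T (hρ T hT) _ (hpoly.1 a) y hy
  rw [Finset.mul_sum, mul_assoc, Finset.sum_mul]
  refine Finset.sum_le_sum fun q _ => ?_
  rw [id, real_inner_self_eq_norm_sq, mul_left_comm]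
  exact mul_le_mul_of_nonneg_left (hval _ (Q.pt_mem_body T q)) (Q.weight_nonneg q)

theorem integral_inner_eq (F : EuclideanSpace ℝ ι →L[ℝ] EuclideanSpace ℝ ι)
    (φ ψ : L2 Ω (EuclideanSpace ℝ ι)) :
    ∫ x in Ω, inner ℝ (F (φ x)) (ψ x) = inner ℝ (F.compLp φ) ψ := by
  rw [L2.inner_def]
  refine integral_congr_ae ?_
  filter_upwards [F.coeFn_compLp φ] with x hx
  rw [hx]

theorem isPW_zero_compLp (F : EuclideanSpace ℝ ι →L[ℝ] EuclideanSpace ℝ ι)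
    {φ : L2 Ω (EuclideanSpace ℝ ι)} (hφ : IsPW 𝒯 0 φ) : IsPW 𝒯 0 (F.compLp φ) := fun T hT => by
  obtain ⟨c, hc⟩ := hφ.exists_ae_eq_const hT
  refine ⟨fun a => MvPolynomial.C (F c a), fun a => by simp, ?_⟩
  filter_upwards [hc, ae_restrict_of_ae_restrict_of_subset (𝒯.openBody_subset hT)
    (F.coeFn_compLp φ)] with x h1 h2 a
  rw [h2, h1]
  simp

/-- Applying a fixed linear map to a piecewise constant gives a piecewise constant. The material
form thus becomes a plain quadrature pairing, to which the exactness hypothesis applies. -/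
theorem QuadRule.form_eq_of_isPW_zero (F : EuclideanSpace ℝ ι →L[ℝ] EuclideanSpace ℝ ι)
    {φ : L2 Ω (EuclideanSpace ℝ ι)} (hφ : IsPW 𝒯 0 φ) (ψ : L2 Ω (EuclideanSpace ℝ ι)) :
    Q.form 𝒯 F φ ψ = Q.form 𝒯 id ψ (F.compLp φ) := by
  rw [Q.form_comm_id, QuadRule.form, QuadRule.form]
  refine Finset.sum_congr rfl fun T hT => ?_
  obtain ⟨c, hc⟩ := hφ.exists_ae_eq_const hT
  have hFc : ∀ᵐ x ∂volume.restrict (openBody T), F.compLp φ x = F c := by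
    filter_upwards [hc, ae_restrict_of_ae_restrict_of_subset (𝒯.openBody_subset hT)
      (F.coeFn_compLp φ)] with x h1 h2
    rw [h2, h1]
  simp only [id, elemVal_eq_of_ae_eq_const hc, elemVal_eq_of_ae_eq_const hFc]

/-- The consistency error of a quadrature rule that is exact against piecewise constants. -/
theorem QuadRule.abs_integral_sub_form_le {C : ℝ} (hC : 0 ≤ C)
    (hQ : ∀ φ : L2 Ω (EuclideanSpace ℝ ι), IsPW 𝒯 2 φ → Q.form 𝒯 id φ φ ≤ C * ‖φ‖ ^ 2)
    (F : EuclideanSpace ℝ ι →L[ℝ] EuclideanSpace ℝ ι) {φ ψ φ₀ : L2 Ω (EuclideanSpace ℝ ι)}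
    (hφ : IsPW 𝒯 2 φ) (hψ : IsPW 𝒯 2 ψ) (hφ₀ : IsPW 𝒯 0 φ₀)
    (hex : ∀ χ, IsPW 𝒯 0 χ → Q.form 𝒯 id ψ χ = inner ℝ ψ χ) :
    |(∫ x in Ω, inner ℝ (F (φ x)) (ψ x)) - Q.form 𝒯 F φ ψ| ≤
      ‖F‖ * (1 + C) * ‖φ - φ₀‖ * ‖ψ‖ := by
  have hφ₀2 := hφ₀.mono (Nat.zero_le 2)
  have hdiff : IsPW 𝒯 2 (φ - φ₀) := (pwSubmodule 𝒯 2 ι).sub_mem hφ hφ₀2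
  -- The φ₀ parts of quadrature and integral coincide; the remainder is estimated separately in
  -- each, which gives the 1 and the C in the factor 1 + C.
  have hsplit : Q.form 𝒯 F φ ψ = Q.form 𝒯 F φ₀ ψ + Q.form 𝒯 F (φ - φ₀) ψ := by
    rw [← QuadRule.form_add_left F hφ₀2 hdiff, add_sub_cancel]
  have hexact : Q.form 𝒯 F φ₀ ψ = inner ℝ (F.compLp φ₀) ψ := by
    rw [QuadRule.form_eq_of_isPW_zero F hφ₀, hex _ (isPW_zero_compLp F hφ₀), real_inner_comm]
  have hI : inner ℝ (F.compLp φ) ψ - inner ℝ (F.compLp φ₀) ψ = inner ℝ (F.compLp (φ - φ₀)) ψ := by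
    rw [← inner_sub_left]
    congr 1
    exact (map_sub (F.compLpL 2 (volume.restrict Ω)) φ φ₀).symm
  have hb1 : |inner ℝ (F.compLp (φ - φ₀)) ψ| ≤ ‖F‖ * ‖φ - φ₀‖ * ‖ψ‖ := by
    refine (abs_real_inner_le_norm _ _).trans ?_
    gcongr
    exact F.norm_compLp_le _
  have hroot : ∀ φ : L2 Ω (EuclideanSpace ℝ ι), IsPW 𝒯 2 φ →
      √(Q.form 𝒯 id φ φ) ≤ √C * ‖φ‖ := fun φ h => by
    refine Real.sqrt_le_iff.2 ⟨by positivity, ?_⟩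
    rw [mul_pow, Real.sq_sqrt hC]
    exact hQ φ h
  have hb2 : |Q.form 𝒯 F (φ - φ₀) ψ| ≤ ‖F‖ * C * ‖φ - φ₀‖ * ‖ψ‖ := by
    refine (QuadRule.abs_form_le F _ _).trans ?_
    calc ‖F‖ * (√(Q.form 𝒯 id (φ - φ₀) (φ - φ₀)) * √(Q.form 𝒯 id ψ ψ))
        ≤ ‖F‖ * ((√C * ‖φ - φ₀‖) * (√C * ‖ψ‖)) := by
          gcongr
          · exact hroot _ hdiff
          · exact hroot _ hψ
      _ = ‖F‖ * (√C * √C) * ‖φ - φ₀‖ * ‖ψ‖ := by ring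
      _ = _ := by rw [Real.mul_self_sqrt hC]
  rw [integral_inner_eq, hsplit, hexact, ← sub_sub, hI]
  refine (abs_sub _ _).trans ?_
  linarith

end Form

/-! ### Pointwise operators -/

theorem isLinearMap_compliance (d : ℕ) (mu muc lam : ℝ) :
    IsLinearMap ℝ (compliance d mu muc lam) where
  map_add τ τ' := by
    ext p
    simp only [compliance, PiLp.add_apply, Finset.sum_add_distrib]
    ring
  map_smul c τ := by
    ext p
    simp only [compliance, PiLp.smul_apply, smul_eq_mul, ← Finset.mul_sum]
    ring

/-- With A = |τ|² and B = τ : τᵀ one has |sym τ|² = (A + B)/2 and |skw τ|² = (A − B)/2. Since (tr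
τ)² ≤ d |sym τ|², the trace term takes away at most the fraction dλ/(2μ + dλ) of the symmetric part,
which leaves |sym τ|²/(2μ + dλ). -/
theorem compliance_coercive (d : ℕ) {mu muc lam : ℝ} (hmu : 0 < mu) (hlam : 0 ≤ lam)
    (τ : Mat d d) :
    min (1 / (2 * mu + d * lam)) (1 / (2 * muc)) * ‖τ‖ ^ 2 ≤
      inner ℝ (compliance d mu muc lam τ) τ := by
  set A := ∑ i, ∑ j, τ (i, j) ^ 2
  set B := ∑ i, ∑ j, τ (i, j) * τ (j, i)
  set t := ∑ i, τ (i, i)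
  have hA : ‖τ‖ ^ 2 = A := by
    rw [EuclideanSpace.norm_sq_eq, Fintype.sum_prod_type]
    simp [A]
  have hA' : ∑ i, ∑ j, τ (j, i) ^ 2 = A := Finset.sum_comm
  have hden : 0 < 2 * mu + d * lam := by positivity
  have hinner : inner ℝ (compliance d mu muc lam τ) τ =
      1 / (2 * mu) * ((A + B) / 2 - lam / (2 * mu + d * lam) * t ^ 2) +
        1 / (2 * muc) * ((A - B) / 2) := by
    have h1 : ∑ i, ∑ j, t * (if i = j then 1 else 0) * τ (i, j) = t ^ 2 := by
      simp [t, ← Finset.mul_sum, pow_two]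
    rw [PiLp.inner_apply, Fintype.sum_prod_type]
    calc ∑ i, ∑ j, inner ℝ (compliance d mu muc lam τ (i, j)) (τ (i, j))
        = ∑ i, ∑ j, (1 / (2 * mu) / 2 * τ (i, j) ^ 2 + 1 / (2 * mu) / 2 * (τ (i, j) * τ (j, i))
            - 1 / (2 * mu) * (lam / (2 * mu + d * lam)) * (t * (if i = j then 1 else 0) * τ (i, j))
            + 1 / (2 * muc) / 2 * τ (i, j) ^ 2 - 1 / (2 * muc) / 2 * (τ (i, j) * τ (j, i))) := by
          refine Finset.sum_congr rfl fun i _ => Finset.sum_congr rfl fun j _ => ?_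
          simp only [compliance, RCLike.inner_apply, conj_trivial]
          change τ (i, j) * _ = _
          simp only [t]
          ring
      _ = _ := by
          simp only [Finset.sum_add_distrib, Finset.sum_sub_distrib, ← Finset.mul_sum]
          rw [h1]
          ring
  have hK : 0 ≤ A - B := by
    have : ∑ i, ∑ j, (τ (i, j) - τ (j, i)) ^ 2 = 2 * (A - B) := by
      have : ∀ i j, (τ (i, j) - τ (j, i)) ^ 2 =
          τ (i, j) ^ 2 + τ (j, i) ^ 2 - 2 * (τ (i, j) * τ (j, i)) := fun i j => by ring
      simp only [this, Finset.sum_add_distrib, Finset.sum_sub_distrib, ← Finset.mul_sum, hA']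
      ring
    have h0 : 0 ≤ ∑ i, ∑ j, (τ (i, j) - τ (j, i)) ^ 2 := by positivity
    linarith
  have hS : t ^ 2 ≤ d * ((A + B) / 2) := by
    have h1 : ∑ i, ∑ j, ((τ (i, j) + τ (j, i)) / 2) ^ 2 = (A + B) / 2 := by
      have : ∀ i j, ((τ (i, j) + τ (j, i)) / 2) ^ 2 =
          1 / 4 * τ (i, j) ^ 2 + 1 / 4 * τ (j, i) ^ 2 + 1 / 2 * (τ (i, j) * τ (j, i)) :=
        fun i j => by ring
      simp only [this, Finset.sum_add_distrib, ← Finset.mul_sum, hA']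
      ring
    have h2 : ∑ i, τ (i, i) ^ 2 ≤ (A + B) / 2 := by
      rw [← h1]
      refine Finset.sum_le_sum fun i _ => ?_
      refine le_trans (le_of_eq ?_) (Finset.single_le_sum
        (f := fun j => ((τ (i, j) + τ (j, i)) / 2) ^ 2) (fun j _ => sq_nonneg _)
        (Finset.mem_univ i))
      ring
    have h3 : t ^ 2 ≤ d * ∑ i, τ (i, i) ^ 2 := by
      simpa using sq_sum_le_card_mul_sum_sq (s := Finset.univ) (f := fun i : Fin d => τ (i, i))
    exact h3.trans (by gcongr)
  have hS0 : 0 ≤ (A + B) / 2 - lam / (2 * mu + d * lam) * t ^ 2 - 2 * mu / (2 * mu + d * lam) *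
      ((A + B) / 2) := by
    have : (A + B) / 2 - lam / (2 * mu + d * lam) * t ^ 2 - 2 * mu / (2 * mu + d * lam) *
      ((A + B) / 2) = lam / (2 * mu + d * lam) * (d * ((A + B) / 2) - t ^ 2) := by
      field_simp
      ring
    rw [this]
    exact mul_nonneg (by positivity) (by linarith)
  have hS1 : 0 ≤ A + B := by
    have h1 : ∑ i, ∑ j, (τ (i, j) + τ (j, i)) ^ 2 = 2 * (A + B) := by
      have : ∀ i j, (τ (i, j) + τ (j, i)) ^ 2 =
          τ (i, j) ^ 2 + τ (j, i) ^ 2 + 2 * (τ (i, j) * τ (j, i)) := fun i j => by ring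
      simp only [this, Finset.sum_add_distrib, ← Finset.mul_sum, hA']
      ring
    have h0 : 0 ≤ ∑ i, ∑ j, (τ (i, j) + τ (j, i)) ^ 2 := by positivity
    linarith
  rw [hinner, hA]
  have e1 : 1 / (2 * mu + d * lam) * ((A + B) / 2) ≤
      1 / (2 * mu) * ((A + B) / 2 - lam / (2 * mu + d * lam) * t ^ 2) := by
    have : 1 / (2 * mu + d * lam) * ((A + B) / 2) =
        1 / (2 * mu) * (2 * mu / (2 * mu + d * lam) * ((A + B) / 2)) := by field_simp
    rw [this]
    gcongr
    linarith
  calc _ = min (1 / (2 * mu + d * lam)) (1 / (2 * muc)) * ((A + B) / 2) +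
        min (1 / (2 * mu + d * lam)) (1 / (2 * muc)) * ((A - B) / 2) := by ring
    _ ≤ 1 / (2 * mu + d * lam) * ((A + B) / 2) + 1 / (2 * muc) * ((A - B) / 2) := by
        gcongr
        · exact min_le_left _ _
        · exact min_le_right _ _
    _ ≤ _ := by gcongr

theorem exists_compliance_clm (d : ℕ) {mu muc lam : ℝ} (hmu : 0 < mu) (hmuc : 0 < muc)
    (hlam : 0 ≤ lam) : ∃ F : Mat d d →L[ℝ] Mat d d, compliance d mu muc lam = F ∧
      ∃ α > 0, ∀ τ, α * ‖τ‖ ^ 2 ≤ inner ℝ (F τ) τ :=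
  ⟨LinearMap.toContinuousLinearMap ((isLinearMap_compliance d mu muc lam).mk' _), rfl,
    min (1 / (2 * mu + d * lam)) (1 / (2 * muc)), by positivity,
    compliance_coercive d hmu hlam⟩

theorem Material.exists_AS_clm (P : Material) (d : ℕ) :
    ∃ F : Mat d d →L[ℝ] Mat d d, P.AS d = F ∧ ∃ α > 0, ∀ τ, α * ‖τ‖ ^ 2 ≤ inner ℝ (F τ) τ :=
  exists_compliance_clm d P.muS_pos P.mucS_pos P.lamS_nonneg

theorem Material.exists_AW_clm (P : Material) {d : ℕ} (hd : d = 2 ∨ d = 3) :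
    ∃ F : Mat (rotDim d) d →L[ℝ] Mat (rotDim d) d, P.AW d = F ∧
      ∃ α > 0, ∀ τ, α * ‖τ‖ ^ 2 ≤ inner ℝ (F τ) τ := by
  rcases hd with rfl | rfl
  · have := P.muW_pos
    refine ⟨(1 / (2 * P.muW)) • ContinuousLinearMap.id ℝ _, rfl, 1 / (2 * P.muW), by positivity,
      fun τ => ?_⟩
    rw [smul_apply, ContinuousLinearMap.id_apply, real_inner_smul_left,
      real_inner_self_eq_norm_sq]
  · exact exists_compliance_clm 3 P.muW_pos P.mucW_pos P.lamW_nonneg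

theorem isLinearMap_asym {d : ℕ} (hd : d = 2 ∨ d = 3) : IsLinearMap ℝ (asym d) := by
  rcases hd with rfl | rfl
  · refine ⟨fun τ τ' => PiLp.ext fun i => ?_, fun c τ => PiLp.ext fun i => ?_⟩
    · change Fin 1 at i
      fin_cases i
      exact add_sub_add_comm (τ (1, 0)) (τ' (1, 0)) (τ (0, 1)) (τ' (0, 1))
    · change Fin 1 at i
      fin_cases i
      exact (mul_sub c (τ (1, 0)) (τ (0, 1))).symm
  · refine ⟨fun τ τ' => PiLp.ext fun i => ?_, fun c τ => PiLp.ext fun i => ?_⟩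
    · change Fin 3 at i
      fin_cases i
      · exact add_sub_add_comm (τ (2, 1)) (τ' (2, 1)) (τ (1, 2)) (τ' (1, 2))
      · exact add_sub_add_comm (τ (0, 2)) (τ' (0, 2)) (τ (2, 0)) (τ' (2, 0))
      · exact add_sub_add_comm (τ (1, 0)) (τ' (1, 0)) (τ (0, 1)) (τ' (0, 1))
    · change Fin 3 at i
      fin_cases i
      · exact (mul_sub c (τ (2, 1)) (τ (1, 2))).symm
      · exact (mul_sub c (τ (0, 2)) (τ (2, 0))).symm
      · exact (mul_sub c (τ (1, 0)) (τ (0, 1))).symm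

theorem exists_asym_clm {d : ℕ} (hd : d = 2 ∨ d = 3) :
    ∃ F : Mat d d →L[ℝ] Vec (rotDim d), asym d = F :=
  ⟨LinearMap.toContinuousLinearMap ((isLinearMap_asym hd).mk' _), rfl⟩

/-! ### Linearity of the weak divergence -/

section Div

variable {d m : ℕ} {Ω Γn : Set (Pt d)}

theorem integrableOn_mul_of_hasCompactSupport {f φ : Pt d → ℝ} (hf : IntegrableOn f Ω)
    (hφ : Continuous φ) (hc : HasCompactSupport φ) : IntegrableOn (fun x => f x * φ x) Ω := by
  obtain ⟨C, hC⟩ := hφ.bounded_above_of_compact_support hc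
  exact hf.mul_bdd (c := C) hφ.aestronglyMeasurable (Filter.Eventually.of_forall hC)

/-- Test functions supported in the open set Ω avoid Γn, which lies on the frontier, and they
already determine the divergence. This turns `wdiv` into a linear operation on fields that have a
divergence. -/
theorem HasDiv.unique (hΩ : IsOpen Ω) (hb : Bornology.IsBounded Ω) (hΓ : Γn ⊆ frontier Ω)
    {τ : Pt d → Mat m d} {w w' : L2 Ω (Vec m)} (h : HasDiv Ω Γn τ w) (h' : HasDiv Ω Γn τ w') :
    w = w' := by
  have key : ∀ i, ∀ᵐ x, x ∈ Ω → w x i - w' x i = 0 := fun i => by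
    refine hΩ.ae_eq_zero_of_integral_contDiff_smul_eq_zero
      ((integrable_coord hb w i).sub (integrable_coord hb w' i)).locallyIntegrableOn
      fun φ hφ hc hs => ?_
    have hdisj : Disjoint (tsupport φ) Γn :=
      (disjoint_frontier_iff_isOpen.2 hΩ).symm.mono hs hΓ
    have e := (h i φ hφ hc hdisj).trans (h' i φ hφ hc hdisj).symm
    rw [← sub_eq_zero, ← integral_sub
      (integrableOn_mul_of_hasCompactSupport (integrable_coord hb w i) hφ.continuous hc)
      (integrableOn_mul_of_hasCompactSupport (integrable_coord hb w' i) hφ.continuous hc)] at e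
    rw [← e, ← integral_indicator hΩ.measurableSet]
    congr with x
    by_cases hx : x ∈ Ω
    · simp [hx]; ring
    · have : φ x = 0 := by
        by_contra h0
        exact hx (hs (subset_tsupport φ h0))
      simp [hx, this]
  refine Lp.ext ?_
  have := (ae_restrict_iff' hΩ.measurableSet).2
    ((ae_all_iff.2 key).mono fun x hx hxΩ i => hx i hxΩ)
  filter_upwards [this] with x hx
  ext i
  exact sub_eq_zero.1 (hx i)

theorem wdiv_eq (hΩ : IsOpen Ω) (hb : Bornology.IsBounded Ω) (hΓ : Γn ⊆ frontier Ω)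
    {τ : Pt d → Mat m d} {w : L2 Ω (Vec m)} (h : HasDiv Ω Γn τ w) : wdiv Ω Γn τ = w := by
  have hex : ∃ w, HasDiv Ω Γn τ w := ⟨w, h⟩
  rw [wdiv, dif_pos hex]
  exact hex.choose_spec.unique hΩ hb hΓ h

/-- The combined field is prescribed only almost everywhere, because representatives of sums in L²
are only determined up to null sets. -/
theorem HasDiv.add_smul (hb : Bornology.IsBounded Ω) {τ τ' τ'' : Pt d → Mat m d}
    {w w' : L2 Ω (Vec m)}
    (hτ : ∀ k, IntegrableOn (fun x => τ x k) Ω) (hτ' : ∀ k, IntegrableOn (fun x => τ' x k) Ω)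
    (h : HasDiv Ω Γn τ w) (h' : HasDiv Ω Γn τ' w') (c : ℝ)
    (hsum : ∀ᵐ x ∂volume.restrict Ω, τ'' x = τ x + c • τ' x) :
    HasDiv Ω Γn τ'' (w + c • w') := fun i φ hφ hc hs => by
  have hp : ∀ j, Continuous (pderiv j φ) := fun j =>
    (hφ.continuous_fderiv (by simp)).clm_apply continuous_const
  have hpc : ∀ j, HasCompactSupport (pderiv j φ) := fun j =>
    (hc.fderiv ℝ).comp_left (g := fun A : Pt d →L[ℝ] ℝ => A (EuclideanSpace.single j 1)) rfl
  have hint : ∀ {τ : Pt d → Mat m d}, (∀ k, IntegrableOn (fun x => τ x k) Ω) →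
      IntegrableOn (fun x => ∑ j, τ x (i, j) * pderiv j φ x) Ω := fun hτ =>
    integrable_finsetSum _ fun j _ => integrableOn_mul_of_hasCompactSupport (hτ (i, j)) (hp j) (hpc j)
  have hw : ∀ w : L2 Ω (Vec m), IntegrableOn (fun x => w x i * φ x) Ω := fun w =>
    integrableOn_mul_of_hasCompactSupport (integrable_coord hb w i) hφ.continuous hc
  have e1 : ∫ x in Ω, (w + c • w') x i * φ x =
      ∫ x in Ω, (w x i * φ x + c * (w' x i * φ x)) := by
    refine integral_congr_ae ?_
    filter_upwards [Lp.coeFn_add w (c • w'), Lp.coeFn_smul c w'] with x h1 h2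
    rw [h1, Pi.add_apply, h2, Pi.smul_apply, PiLp.add_apply, PiLp.smul_apply, smul_eq_mul]
    ring
  have e2 : ∫ x in Ω, ∑ j, τ'' x (i, j) * pderiv j φ x =
      ∫ x in Ω, ((∑ j, τ x (i, j) * pderiv j φ x) + c * ∑ j, τ' x (i, j) * pderiv j φ x) := by
    refine integral_congr_ae ?_
    filter_upwards [hsum] with x hx
    rw [Finset.mul_sum, ← Finset.sum_add_distrib]
    refine Finset.sum_congr rfl fun j _ => ?_
    rw [hx, PiLp.add_apply, PiLp.smul_apply, smul_eq_mul]
    ring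
  rw [e1, e2, integral_add (hw w) ((hw w').const_mul c),
    integral_add (hint hτ) ((hint hτ').const_mul c), integral_const_mul, integral_const_mul,
    h i φ hφ hc hs, h' i φ hφ hc hs]
  ring

theorem hasDiv_wdiv {τ : Pt d → Mat m d} (h : ∃ w, HasDiv Ω Γn τ w) :
    HasDiv Ω Γn τ (wdiv Ω Γn τ) := by
  rw [wdiv, dif_pos h]
  exact h.choose_spec

theorem IsLengthScale.integrable_smul {L : ℝ} {ell : Pt d → ℝ} (hell : IsLengthScale Ω L ell)
    (hΩ : IsOpen Ω) (hb : Bornology.IsBounded Ω) (ω : L2 Ω (Mat m d)) (k : Fin m × Fin d) :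
    IntegrableOn (fun x => (ell x • ω x) k) Ω := by
  obtain ⟨hc, -, G, -, -, hL⟩ := hell
  have hmem : MemLp ell ∞ (volume.restrict Ω) :=
    ⟨hc.aestronglyMeasurable hΩ.measurableSet,
      (le_self_add.trans hL).trans_lt ENNReal.ofReal_lt_top⟩
  exact ((integrable_coord hb ω k).essSup_smul hmem.1 (by
    simpa [eLpNorm_exponent_top, eLpNormEssSup] using hmem.2.ne))

end Div

/-! ### Square linear systems in finite dimension -/

theorem isLinearMap_of_map_add_smul {V W : Type*} [AddCommGroup V] [Module ℝ V] [AddCommGroup W]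
    [Module ℝ W] {f : V → W} (h : ∀ x y (c : ℝ), f (x + c • y) = f x + c • f y) :
    IsLinearMap ℝ f := by
  have h0 : f 0 = 0 := by simpa using h 0 0 1
  exact ⟨fun x y => by simpa using h x y 1, fun c x => by simpa [h0] using h 0 x c⟩

/-- The form induces a linear map from V to its dual. The dimensions agree, so injectivity gives
surjectivity. -/
theorem existsUnique_forall_eq_of_injective {V : Type*} [AddCommGroup V] [Module ℝ V]
    [FiniteDimensional ℝ V] {G : V → V → ℝ}
    (hG1 : ∀ p p' q (c : ℝ), G (p + c • p') q = G p q + c * G p' q)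
    (hG2 : ∀ p q q' (c : ℝ), G p (q + c • q') = G p q + c * G p q')
    (hinj : ∀ p, (∀ q, G p q = 0) → p = 0) {r : V → ℝ}
    (hr : ∀ q q' (c : ℝ), r (q + c • q') = r q + c * r q') : ∃! p, ∀ q, G p q = r q := by
  let Φ : V → Module.Dual ℝ V := fun p => (isLinearMap_of_map_add_smul (hG2 p)).mk' (G p)
  have hΦ : IsLinearMap ℝ Φ := isLinearMap_of_map_add_smul fun p p' c =>
    LinearMap.ext fun q => hG1 p p' q c
  let Ψ : V →ₗ[ℝ] Module.Dual ℝ V := hΦ.mk' Φ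
  have hΨ : Function.Injective Ψ := (injective_iff_map_eq_zero Ψ).2 fun p hp =>
    hinj p fun q => LinearMap.congr_fun hp q
  have hΨs : Function.Surjective Ψ :=
    (LinearMap.injective_iff_surjective_of_finrank_eq_finrank
      (Subspace.dual_finrank_eq (K := ℝ) (V := V)).symm).1 hΨ
  obtain ⟨p, hp⟩ := hΨs ((isLinearMap_of_map_add_smul hr).mk' r)
  refine ⟨p, fun q => LinearMap.congr_fun hp q, fun p' hp' => hΨ ?_⟩
  rw [hp]
  exact LinearMap.ext hp'

/-! ### The Hilbert norm of a pair -/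

section PairNorm

variable {E F : Type*} [NormedAddCommGroup E] [NormedAddCommGroup F]

theorem pairNorm_nonneg (p : E × F) : 0 ≤ pairNorm p := Real.sqrt_nonneg _

theorem norm_fst_le_pairNorm (p : E × F) : ‖p.1‖ ≤ pairNorm p :=
  Real.le_sqrt_of_sq_le (le_add_of_nonneg_right (sq_nonneg _))

theorem norm_snd_le_pairNorm (p : E × F) : ‖p.2‖ ≤ pairNorm p :=
  Real.le_sqrt_of_sq_le (le_add_of_nonneg_left (sq_nonneg _))

theorem pairNorm_add_le (p q : E × F) : pairNorm (p + q) ≤ pairNorm p + pairNorm q := by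
  have h : ∀ p : E × F, pairNorm p = ‖WithLp.toLp 2 p‖ := fun p => by
    rw [WithLp.prod_norm_eq_of_L2]
    rfl
  rw [h, h, h, WithLp.toLp_add]
  exact norm_add_le _ _

theorem eq_zero_of_pairNorm_le_zero {p : E × F} (h : pairNorm p ≤ 0) : p = 0 :=
  Prod.ext (norm_le_zero_iff.1 ((norm_fst_le_pairNorm p).trans h))
    (norm_le_zero_iff.1 ((norm_snd_le_pairNorm p).trans h))

end PairNorm

/-- The projection p of z satisfies (p, p) = (z, p) = (a, p) ≤ ‖a‖ ‖p‖. It is used with z the error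
of ∇·ℓω and a the asymmetry of the stress error, so that no bound on z itself is required. -/
theorem norm_l2Proj_le {H : Type*} [NormedAddCommGroup H] [InnerProductSpace ℝ H]
    {K : Submodule ℝ H} {z a : H} (h : ∀ r ∈ K, inner ℝ z r = inner ℝ a r) :
    ‖l2Proj K z‖ ≤ ‖a‖ := by
  rw [l2Proj]
  split_ifs with hex
  · obtain ⟨hp, hq⟩ := hex.choose_spec
    set p := hex.choose
    have h1 : inner ℝ p p = inner ℝ a p := by
      have := hq p hp
      rw [inner_sub_left, h p hp] at this
      linarith
    by_contra! hlt
    have h2 := (le_abs_self _).trans (abs_real_inner_le_norm a p)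
    rw [← h1, real_inner_self_eq_norm_sq, pow_two] at h2
    exact absurd (le_of_mul_le_mul_right h2 ((norm_nonneg a).trans_lt hlt)) (not_le.2 hlt)
  · simp

/-! ### The form `B` -/

section FormB

variable {d : ℕ} {Ω Γn : Set (Pt d)} {ell : Pt d → ℝ}

theorem formAsym_eq {F : Mat d d →L[ℝ] Vec (rotDim d)} (hF : asym d = F) (σ : L2 Ω (Mat d d))
    (r : L2 Ω (Vec (rotDim d))) : formAsym σ r = inner ℝ (F.compLp σ) r := by
  rw [formAsym, L2.inner_def]
  refine integral_congr_ae ?_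
  filter_upwards [F.coeFn_compLp σ] with x hx
  rw [hx, hF]

theorem formB_add_smul_right (hd : d = 2 ∨ d = 3) (η : Stress Ω) (v v' : Kinem Ω) (c : ℝ) :
    formB Γn ell η (v + c • v') = formB Γn ell η v + c * formB Γn ell η v' := by
  obtain ⟨F, hF⟩ := exists_asym_clm hd
  simp only [formB, formAsym_eq hF, Prod.fst_add, Prod.snd_add, Prod.smul_fst, Prod.smul_snd,
    inner_add_right, real_inner_smul_right]
  ring

theorem MemSigma.add_smul (hb : Bornology.IsBounded Ω) {σ σ' : L2 Ω (Mat d d)}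
    (h : MemSigma Ω Γn σ) (h' : MemSigma Ω Γn σ') (c : ℝ) :
    HasDiv Ω Γn (σ + c • σ' : L2 Ω (Mat d d)) (divS Γn σ + c • divS Γn σ') := by
  refine (hasDiv_wdiv h).add_smul hb (integrable_coord hb σ) (integrable_coord hb σ')
    (hasDiv_wdiv h') c ?_
  filter_upwards [Lp.coeFn_add σ (c • σ'), Lp.coeFn_smul c σ'] with x h1 h2
  rw [h1, Pi.add_apply, h2, Pi.smul_apply]

theorem MemW.add_smul {L : ℝ} (hΩ : IsOpen Ω) (hb : Bornology.IsBounded Ω)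
    (hell : IsLengthScale Ω L ell) {ω ω' : L2 Ω (Mat (rotDim d) d)}
    (h : MemW Ω Γn ell ω) (h' : MemW Ω Γn ell ω') (c : ℝ) :
    HasDiv Ω Γn (fun x => ell x • (ω + c • ω' : L2 Ω (Mat (rotDim d) d)) x)
      (divW Γn ell ω + c • divW Γn ell ω') := by
  refine (hasDiv_wdiv h).add_smul hb (hell.integrable_smul hΩ hb ω) (hell.integrable_smul hΩ hb ω')
    (hasDiv_wdiv h') c ?_
  filter_upwards [Lp.coeFn_add ω (c • ω'), Lp.coeFn_smul c ω'] with x h1 h2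
  rw [h1, Pi.add_apply, h2, Pi.smul_apply, smul_add, smul_comm]

theorem divS_add_smul (hΩ : IsOpen Ω) (hb : Bornology.IsBounded Ω) (hΓ : Γn ⊆ frontier Ω)
    {σ σ' : L2 Ω (Mat d d)} (h : MemSigma Ω Γn σ) (h' : MemSigma Ω Γn σ') (c : ℝ) :
    divS Γn (σ + c • σ') = divS Γn σ + c • divS Γn σ' :=
  wdiv_eq hΩ hb hΓ (h.add_smul hb h' c)

theorem divW_add_smul {L : ℝ} (hΩ : IsOpen Ω) (hb : Bornology.IsBounded Ω) (hΓ : Γn ⊆ frontier Ω)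
    (hell : IsLengthScale Ω L ell) {ω ω' : L2 Ω (Mat (rotDim d) d)}
    (h : MemW Ω Γn ell ω) (h' : MemW Ω Γn ell ω') (c : ℝ) :
    divW Γn ell (ω + c • ω') = divW Γn ell ω + c • divW Γn ell ω' :=
  wdiv_eq hΩ hb hΓ (h.add_smul hΩ hb hell h' c)

theorem formB_add_smul_left (hd : d = 2 ∨ d = 3) {L : ℝ} (hΩ : IsOpen Ω)
    (hb : Bornology.IsBounded Ω) (hΓ : Γn ⊆ frontier Ω) (hell : IsLengthScale Ω L ell)
    {η η' : Stress Ω} (h : MemX Ω Γn ell η) (h' : MemX Ω Γn ell η') (c : ℝ) (v : Kinem Ω) :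
    formB Γn ell (η + c • η') v = formB Γn ell η v + c * formB Γn ell η' v := by
  obtain ⟨F, hF⟩ := exists_asym_clm hd
  have hFl : F.compLp (η.1 + c • η'.1) = F.compLp η.1 + c • F.compLp η'.1 := by
    have := map_add (F.compLpL 2 (volume.restrict Ω)) η.1 (c • η'.1)
    rwa [map_smul] at this
  simp only [formB, formAsym_eq hF, Prod.fst_add, Prod.snd_add, Prod.smul_fst, Prod.smul_snd,
    divS_add_smul hΩ hb hΓ h.1 h'.1, divW_add_smul hΩ hb hΓ hell h.2 h'.2, hFl, inner_add_left,
    real_inner_smul_left]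
  ring

end FormB

theorem formA_eq {d : ℕ} {Ω : Set (Pt d)} {P : Material} {FS : Mat d d →L[ℝ] Mat d d}
    {FW : Mat (rotDim d) d →L[ℝ] Mat (rotDim d) d} (hS : P.AS d = FS) (hW : P.AW d = FW)
    (η η' : Stress Ω) : formA P η η' =
      (∫ x in Ω, inner ℝ (FS (η.1 x)) (η'.1 x)) + ∫ x in Ω, inner ℝ (FW (η.2 x)) (η'.2 x) := by
  rw [formA, hS, hW]

/-! ### The discrete problem -/

section Discrete

variable {d : ℕ} {Ω Γn : Set (Pt d)} {ell : Pt d → ℝ} {𝒯 : Mesh Ω} {κ : Type} [Fintype κ]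
  {Q : QuadRule d κ} {P : Material}

theorem FESpaces.memX (S : FESpaces Γn ell 𝒯) {η : Stress Ω} (h : η ∈ S.Xh) : MemX Ω Γn ell η :=
  ⟨S.Sh_conf _ h.1, S.Wh_conf _ h.2⟩

theorem FESpaces.isPW_fst (S : FESpaces Γn ell 𝒯) {η : Stress Ω} (h : η ∈ S.Xh) : IsPW 𝒯 2 η.1 :=
  S.Sh_poly _ h.1

theorem FESpaces.isPW_snd (S : FESpaces Γn ell 𝒯) {η : Stress Ω} (h : η ∈ S.Xh) : IsPW 𝒯 2 η.2 :=
  S.Wh_poly _ h.2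

theorem FESpaces.formAh_add_smul_left (hd : d = 2 ∨ d = 3) (S : FESpaces Γn ell 𝒯)
    {η η' : Stress Ω} (h : η ∈ S.Xh) (h' : η' ∈ S.Xh) (c : ℝ) (ζ : Stress Ω) :
    Q.formAh 𝒯 P (η + c • η') ζ = Q.formAh 𝒯 P η ζ + c * Q.formAh 𝒯 P η' ζ := by
  obtain ⟨FS, hS, -⟩ := P.exists_AS_clm d
  obtain ⟨FW, hW, -⟩ := P.exists_AW_clm hd
  have hc := S.Xh.smul_mem c h'
  rw [QuadRule.formAh, QuadRule.formAh, QuadRule.formAh, hS, hW, Prod.fst_add, Prod.snd_add,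
    QuadRule.form_add_left FS (S.isPW_fst h) (S.isPW_fst hc),
    QuadRule.form_add_left FW (S.isPW_snd h) (S.isPW_snd hc), Prod.smul_fst, Prod.smul_snd,
    QuadRule.form_smul_left FS (S.isPW_fst h'), QuadRule.form_smul_left FW (S.isPW_snd h')]
  ring

theorem FESpaces.formAh_add_smul_right (S : FESpaces Γn ell 𝒯)
    {η η' : Stress Ω} (h : η ∈ S.Xh) (h' : η' ∈ S.Xh) (c : ℝ) (ζ : Stress Ω) :
    Q.formAh 𝒯 P ζ (η + c • η') = Q.formAh 𝒯 P ζ η + c * Q.formAh 𝒯 P ζ η' := by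
  have hc := S.Xh.smul_mem c h'
  rw [QuadRule.formAh, QuadRule.formAh, QuadRule.formAh, Prod.fst_add, Prod.snd_add,
    QuadRule.form_add_right _ (S.isPW_fst h) (S.isPW_fst hc),
    QuadRule.form_add_right _ (S.isPW_snd h) (S.isPW_snd hc), Prod.smul_fst, Prod.smul_snd,
    QuadRule.form_smul_right _ (S.isPW_fst h'), QuadRule.form_smul_right _ (S.isPW_snd h')]
  ring

/-- Coercivity of `A_h` on `X_h`. -/
theorem FESpaces.formAh_coercive {S : FESpaces Γn ell 𝒯} {c₁ c₂ : ℝ} (hc₁ : 0 < c₁)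
    (hQ : Q.NormEquiv S c₁ c₂) {α : ℝ} (hα : 0 ≤ α)
    (hS : ∀ τ, α * ‖τ‖ ^ 2 ≤ inner ℝ (P.AS d τ) τ) (hW : ∀ τ, α * ‖τ‖ ^ 2 ≤ inner ℝ (P.AW d τ) τ)
    {η : Stress Ω} (h : η ∈ S.Xh) : α * c₁ ^ 2 * pairNorm η ^ 2 ≤ Q.formAh 𝒯 P η η := by
  have hip : 0 ≤ Q.ip 𝒯 η η := add_nonneg (Q.form_self_nonneg _) (Q.form_self_nonneg _)
  have h1 : c₁ ^ 2 * pairNorm η ^ 2 ≤ Q.ip 𝒯 η η := by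
    have h0 : 0 ≤ c₁ * pairNorm η := mul_nonneg hc₁.le (pairNorm_nonneg η)
    calc c₁ ^ 2 * pairNorm η ^ 2 = (c₁ * pairNorm η) ^ 2 := by ring
      _ ≤ Q.norm 𝒯 η ^ 2 := pow_le_pow_left₀ h0 (hQ η h).1 2
      _ = _ := Real.sq_sqrt hip
  calc α * c₁ ^ 2 * pairNorm η ^ 2 = α * (c₁ ^ 2 * pairNorm η ^ 2) := by ring
    _ ≤ α * Q.ip 𝒯 η η := by gcongr
    _ ≤ _ := by
        rw [QuadRule.ip, mul_add]
        exact add_le_add (QuadRule.mul_form_id_le hS _) (QuadRule.mul_form_id_le hW _)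

theorem FESpaces.abs_formAh_le {S : FESpaces Γn ell 𝒯} {C : ℝ} (hC : 0 ≤ C)
    (hQ : ∀ {ι : Type} [Fintype ι] (φ : L2 Ω (EuclideanSpace ℝ ι)), IsPW 𝒯 2 φ →
      Q.form 𝒯 id φ φ ≤ C * ‖φ‖ ^ 2)
    {FS : Mat d d →L[ℝ] Mat d d} {FW : Mat (rotDim d) d →L[ℝ] Mat (rotDim d) d}
    (hS : P.AS d = FS) (hW : P.AW d = FW) {η η' : Stress Ω} (h : η ∈ S.Xh) (h' : η' ∈ S.Xh) :
    |Q.formAh 𝒯 P η η'| ≤ (‖FS‖ + ‖FW‖) * C * pairNorm η * pairNorm η' := by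
  have hroot : ∀ {ι : Type} [Fintype ι] (φ : L2 Ω (EuclideanSpace ℝ ι)), IsPW 𝒯 2 φ →
      √(Q.form 𝒯 id φ φ) ≤ √C * ‖φ‖ := fun φ h => by
    refine Real.sqrt_le_iff.2 ⟨by positivity, ?_⟩
    rw [mul_pow, Real.sq_sqrt hC]
    exact hQ φ h
  have key : ∀ {ι : Type} [Fintype ι] (F : EuclideanSpace ℝ ι →L[ℝ] EuclideanSpace ℝ ι)
      (φ ψ : L2 Ω (EuclideanSpace ℝ ι)), IsPW 𝒯 2 φ → IsPW 𝒯 2 ψ → ‖φ‖ ≤ pairNorm η →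
      ‖ψ‖ ≤ pairNorm η' → |Q.form 𝒯 F φ ψ| ≤ ‖F‖ * C * pairNorm η * pairNorm η' :=
    fun F φ ψ hφ hψ h1 h2 => by
      calc |Q.form 𝒯 F φ ψ| ≤ ‖F‖ * (√(Q.form 𝒯 id φ φ) * √(Q.form 𝒯 id ψ ψ)) :=
            QuadRule.abs_form_le F _ _
        _ ≤ ‖F‖ * ((√C * ‖φ‖) * (√C * ‖ψ‖)) := by
            gcongr
            · exact hroot _ hφ
            · exact hroot _ hψ
        _ = ‖F‖ * (√C * √C) * ‖φ‖ * ‖ψ‖ := by ring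
        _ = ‖F‖ * C * ‖φ‖ * ‖ψ‖ := by rw [Real.mul_self_sqrt hC]
        _ ≤ _ := by
            have := pairNorm_nonneg η
            gcongr
  rw [QuadRule.formAh, hS, hW]
  refine (abs_add_le _ _).trans ?_
  have h1 := key FS η.1 η'.1 (S.isPW_fst h) (S.isPW_fst h') (norm_fst_le_pairNorm η)
    (norm_fst_le_pairNorm η')
  have h2 := key FW η.2 η'.2 (S.isPW_snd h) (S.isPW_snd h') (norm_snd_le_pairNorm η)
    (norm_snd_le_pairNorm η')
  linarith

/-- Stability of the multipoint stress method. -/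
theorem FESpaces.stability (hd : d = 2 ∨ d = 3) {L : ℝ} (hΩ : IsOpen Ω)
    (hb : Bornology.IsBounded Ω) (hΓ : Γn ⊆ frontier Ω) (hell : IsLengthScale Ω L ell)
    {S : FESpaces Γn ell 𝒯} {a CA β : ℝ} (ha : 0 < a) (hβ : 0 < β)
    (hcoer : ∀ η ∈ S.Xh, a * pairNorm η ^ 2 ≤ Q.formAh 𝒯 P η η)
    (hbdd : ∀ η ∈ S.Xh, ∀ η' ∈ S.Xh, |Q.formAh 𝒯 P η η'| ≤ CA * pairNorm η * pairNorm η')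
    (hst : S.ElasticityStable β) {F : Stress Ω → ℝ} {ε : ℝ}
    (hF : ∀ η ∈ S.Xh, |F η| ≤ ε * pairNorm η) {e : Stress Ω} {w : Kinem Ω} (he : e ∈ S.Xh)
    (hw : w ∈ S.Yh) (heq : ∀ η' ∈ S.Xh, ∀ v' ∈ S.Yh,
      Q.formAh 𝒯 P e η' - formB Γn ell η' w + formB Γn ell e v' = F η') (hε : 0 ≤ ε)
    (hCA : 0 ≤ CA) :
    pairNorm e ≤ ε / a ∧ pairNorm w ≤ 2 / β * (CA * (ε / a) + ε) := by
  have h1 : pairNorm e ≤ ε / a := by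
    rw [le_div_iff₀ ha]
    by_contra! hlt
    have hpos : 0 < pairNorm e := by
      by_contra! h0
      have := le_antisymm h0 (pairNorm_nonneg e)
      rw [this, zero_mul] at hlt
      linarith
    -- On the diagonal the two B-terms cancel and only A_h remains.
    have h2 := heq e he w hw
    rw [sub_add_cancel] at h2
    have h3 := hcoer e he
    rw [h2] at h3
    have h4 := h3.trans ((le_abs_self _).trans (hF e he))
    have : a * pairNorm e ≤ ε := le_of_mul_le_mul_right (by linarith [h4, pow_two (pairNorm e)]) hpos
    linarith
  refine ⟨h1, ?_⟩
  by_cases hw0 : w = 0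
  · have hz : pairNorm w = 0 := by simp [hw0, pairNorm]
    rw [hz]
    positivity
  -- B contains −(∇·σ, u) while the inf-sup condition has +(∇·σ, u); reversing the displacement
  -- reconciles the signs.
  let v : Kinem Ω := (-w.1, w.2)
  have hv : v ∈ S.Yh := ⟨S.Uh.neg_mem hw.1, hw.2⟩
  have hv0 : v ≠ 0 := fun h => hw0 (Prod.ext (neg_eq_zero.1 (congrArg Prod.fst h))
    (congrArg Prod.snd h : v.2 = (0 : Kinem Ω).2))
  have hvw : pairNorm v = pairNorm w := by simp [pairNorm, v]
  -- Giving up half of β makes the inequality strict, so an actual σ nearly attains the supremum.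
  have hlt : β / 2 < ⨆ σ : S.Sh, (inner ℝ (divS Γn σ.1) v.1 + formAsym σ.1 v.2) /
      (normX Γn ell (σ.1, 0) * pairNorm v) := (half_lt_self hβ).trans_le (hst v hv hv0)
  obtain ⟨σ, hσ⟩ := exists_lt_of_lt_ciSup hlt
  set N := normX Γn ell (σ.1, 0)
  have hN0 : 0 ≤ N := Real.sqrt_nonneg _
  have hdiv0 : divW Γn ell (0 : L2 Ω (Mat (rotDim d) d)) = 0 := by
    have h0 := (S.memX S.Xh.zero_mem).2
    have := divW_add_smul hΩ hb hΓ hell h0 h0 1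
    simpa using this
  have hσX : ((σ.1, 0) : Stress Ω) ∈ S.Xh := ⟨σ.2, S.Wh.zero_mem⟩
  have hB : formB Γn ell (σ.1, 0) w = inner ℝ (divS Γn σ.1) v.1 + formAsym σ.1 v.2 := by
    simp [formB, hdiv0, v]
  have hB0 : formB Γn ell e 0 = 0 := by
    have := formB_add_smul_right (Γn := Γn) (ell := ell) hd e 0 0 1
    simpa using this
  have heq' := heq _ hσX 0 S.Yh.zero_mem
  rw [hB0, add_zero] at heq'
  have hσN : pairNorm ((σ.1, 0) : Stress Ω) ≤ N := by
    refine Real.sqrt_le_sqrt ?_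
    simp only [norm_zero]
    nlinarith [sq_nonneg ‖divS Γn σ.1‖, sq_nonneg ‖divW Γn ell (0 : L2 Ω (Mat (rotDim d) d))‖]
  have hBle : formB Γn ell (σ.1, 0) w ≤ (CA * (ε / a) + ε) * N := by
    have h2 := (abs_le.1 (hbdd e he _ hσX)).2
    have h3 := (abs_le.1 (hF _ hσX)).1
    have h4 : CA * pairNorm e * pairNorm ((σ.1, 0) : Stress Ω) ≤ CA * (ε / a) * N := by
      have := pairNorm_nonneg ((σ.1, 0) : Stress Ω)
      have : 0 ≤ ε / a := by positivity
      gcongr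
    have h5 : ε * pairNorm ((σ.1, 0) : Stress Ω) ≤ ε * N := by gcongr
    linarith
  rw [← hB, hvw] at hσ
  have hw' := pairNorm_nonneg w
  -- A vanishing denominator would make the quotient 0 by convention, which is not above β/2.
  have hpos : 0 < N * pairNorm w := by
    by_contra! h0
    have h00 : N * pairNorm w = 0 := le_antisymm h0 (mul_nonneg hN0 hw')
    rw [h00, div_zero] at hσ
    linarith
  have hN : 0 < N := pos_of_mul_pos_left hpos hw'
  rw [lt_div_iff₀ hpos] at hσ
  have h6 : β / 2 * pairNorm w ≤ CA * (ε / a) + ε :=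
    le_of_mul_le_mul_right (by linarith) hN
  calc pairNorm w = 2 / β * (β / 2 * pairNorm w) := by field_simp
    _ ≤ _ := by gcongr

theorem FESpaces.finiteDimensional_Xh (S : FESpaces Γn ell 𝒯) : FiniteDimensional ℝ S.Xh := by
  have h1 : FiniteDimensional ℝ S.Sh :=
    have := finiteDimensional_pwSubmodule (𝒯 := 𝒯) (ι := Fin d × Fin d)
    Submodule.finiteDimensional_of_le (S₂ := pwSubmodule 𝒯 2 (Fin d × Fin d)) S.Sh_poly
  have h2 : FiniteDimensional ℝ S.Wh :=
    have := finiteDimensional_pwSubmodule (𝒯 := 𝒯) (ι := Fin (rotDim d) × Fin d)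
    Submodule.finiteDimensional_of_le (S₂ := pwSubmodule 𝒯 2 (Fin (rotDim d) × Fin d)) S.Wh_poly
  exact Module.Finite.iff_fg.2 ((Module.Finite.iff_fg.1 h1).prod (Module.Finite.iff_fg.1 h2))

theorem FESpaces.finiteDimensional_Yh (S : FESpaces Γn ell 𝒯) : FiniteDimensional ℝ S.Yh := by
  have h1 : FiniteDimensional ℝ S.Uh :=
    have := finiteDimensional_pwSubmodule (𝒯 := 𝒯) (ι := Fin d)
    Submodule.finiteDimensional_of_le (S₂ := pwSubmodule 𝒯 2 (Fin d))
      fun u hu => (S.Uh_poly u hu).mono one_le_two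
  have h2 : FiniteDimensional ℝ S.Rh :=
    have := finiteDimensional_pwSubmodule (𝒯 := 𝒯) (ι := Fin (rotDim d))
    Submodule.finiteDimensional_of_le (S₂ := pwSubmodule 𝒯 2 (Fin (rotDim d)))
      fun u hu => (S.Rh_poly u hu).mono one_le_two
  exact Module.Finite.iff_fg.2 ((Module.Finite.iff_fg.1 h1).prod (Module.Finite.iff_fg.1 h2))

/-- A stable discrete problem is uniquely solvable. -/
theorem FESpaces.existsUnique_isMSMFE (hd : d = 2 ∨ d = 3) {L : ℝ} (hΩ : IsOpen Ω)
    (hb : Bornology.IsBounded Ω) (hΓ : Γn ⊆ frontier Ω) (hell : IsLengthScale Ω L ell)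
    {S : FESpaces Γn ell 𝒯}
    (hinj : ∀ e ∈ S.Xh, ∀ w ∈ S.Yh, (∀ η' ∈ S.Xh, ∀ v' ∈ S.Yh,
      Q.formAh 𝒯 P e η' - formB Γn ell η' w + formB Γn ell e v' = 0) → e = 0 ∧ w = 0)
    (g : Stress Ω →ₗ[ℝ] ℝ) (f : Kinem Ω) :
    ∃! p : Stress Ω × Kinem Ω, S.IsMSMFE Q P g f p.1 p.2 := by
  have := S.finiteDimensional_Xh
  have := S.finiteDimensional_Yh
  have hex : ∃! p : S.Xh × S.Yh, ∀ q : S.Xh × S.Yh, Q.formAh 𝒯 P p.1.1 q.1.1 -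
      formB Γn ell q.1.1 p.2.1 + formB Γn ell p.1.1 q.2.1 = g q.1.1 + loadF f q.2.1 := by
    refine existsUnique_forall_eq_of_injective (G := fun p q : S.Xh × S.Yh =>
      Q.formAh 𝒯 P p.1.1 q.1.1 - formB Γn ell q.1.1 p.2.1 + formB Γn ell p.1.1 q.2.1)
      (fun p p' q c => ?_) (fun p q q' c => ?_) (fun p hp => ?_)
      (r := fun q : S.Xh × S.Yh => g q.1.1 + loadF f q.2.1) fun q q' c => ?_
    · have e1 := S.formAh_add_smul_left (Q := Q) (P := P) hd p.1.2 p'.1.2 c q.1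
      have e2 := formB_add_smul_left hd hΩ hb hΓ hell (S.memX p.1.2) (S.memX p'.1.2) c q.2.1
      have e3 := formB_add_smul_right (Γn := Γn) (ell := ell) hd q.1.1 p.2.1 p'.2.1 c
      simp only [Prod.fst_add, Prod.snd_add, Prod.smul_fst, Prod.smul_snd, Submodule.coe_add,
        Submodule.coe_smul]
      rw [e1, e2, e3]
      ring
    · have e1 := S.formAh_add_smul_right (Q := Q) (P := P) q.1.2 q'.1.2 c p.1
      have e2 := formB_add_smul_left hd hΩ hb hΓ hell (S.memX q.1.2) (S.memX q'.1.2) c p.2.1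
      have e3 := formB_add_smul_right (Γn := Γn) (ell := ell) hd p.1.1 q.2.1 q'.2.1 c
      simp only [Prod.fst_add, Prod.snd_add, Prod.smul_fst, Prod.smul_snd, Submodule.coe_add,
        Submodule.coe_smul]
      rw [e1, e2, e3]
      ring
    · have h := hinj p.1 p.1.2 p.2 p.2.2 fun η' hη' v' hv' => hp (⟨η', hη'⟩, ⟨v', hv'⟩)
      exact Prod.ext (Subtype.ext h.1) (Subtype.ext h.2)
    · simp only [loadF, Prod.fst_add, Prod.snd_add, Prod.smul_fst, Prod.smul_snd,
        Submodule.coe_add, Submodule.coe_smul, map_add, map_smul, inner_add_right,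
        real_inner_smul_right, smul_eq_mul]
      ring
  obtain ⟨p, hp, huniq⟩ := hex
  refine ⟨(p.1.1, p.2.1), ⟨p.1.2, p.2.2, fun η' hη' v' hv' => hp (⟨η', hη'⟩, ⟨v', hv'⟩)⟩, ?_⟩
  rintro ⟨η, v⟩ ⟨hη, hv, h⟩
  have := huniq (⟨η, hη⟩, ⟨v, hv⟩) fun q => h q.1 q.1.2 q.2 q.2.2
  rw [← this]

end Discrete

/-! ### Consistency error and divergence errors -/

section Consistency

variable {d : ℕ} {Ω Γn : Set (Pt d)} {ell : Pt d → ℝ} {𝒯 : Mesh Ω} {κ : Type} [Fintype κ]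
  {Q : QuadRule d κ} {P : Material}

theorem QuadRule.form_zero_right {ι : Type} [Fintype ι] (φ : L2 Ω (EuclideanSpace ℝ ι)) :
    Q.form 𝒯 id φ 0 = 0 := by
  have h := QuadRule.form_smul_right (Q := Q) (𝒯 := 𝒯) id (pwSubmodule 𝒯 2 ι).zero_mem 0 φ
  rwa [zero_smul, zero_mul] at h

theorem QuadRule.Exact.form_fst {S : FESpaces Γn ell 𝒯} (hQ : Q.Exact S) {η : Stress Ω}
    (h : η ∈ S.Xh) {χ : L2 Ω (Mat d d)} (hχ : IsPW 𝒯 0 χ) :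
    Q.form 𝒯 id η.1 χ = inner ℝ η.1 χ := by
  have := hQ η h (χ, 0) hχ (pwSubmodule 𝒯 0 _).zero_mem
  simpa [QuadRule.ip, QuadRule.form_zero_right] using this

theorem QuadRule.Exact.form_snd {S : FESpaces Γn ell 𝒯} (hQ : Q.Exact S) {η : Stress Ω}
    (h : η ∈ S.Xh) {χ : L2 Ω (Mat (rotDim d) d)} (hχ : IsPW 𝒯 0 χ) :
    Q.form 𝒯 id η.2 χ = inner ℝ η.2 χ := by
  have := hQ η h (0, χ) (pwSubmodule 𝒯 0 _).zero_mem hχ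
  simpa [QuadRule.ip, QuadRule.form_zero_right] using this

/-- The consistency error `⟨A η_h, η'⟩ - ⟨A_h η_h, η'⟩`. -/
theorem FESpaces.abs_formA_sub_formAh_le {S : FESpaces Γn ell 𝒯} {C : ℝ} (hC : 0 ≤ C)
    (hQ : ∀ {ι : Type} [Fintype ι] (φ : L2 Ω (EuclideanSpace ℝ ι)), IsPW 𝒯 2 φ →
      Q.form 𝒯 id φ φ ≤ C * ‖φ‖ ^ 2) (hex : Q.Exact S)
    {FS : Mat d d →L[ℝ] Mat d d} {FW : Mat (rotDim d) d →L[ℝ] Mat (rotDim d) d}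
    (hS : P.AS d = FS) (hW : P.AW d = FW) {η η' φ : Stress Ω} (h : η ∈ S.Xh) (h' : η' ∈ S.Xh)
    (hφ₁ : IsPW 𝒯 0 φ.1) (hφ₂ : IsPW 𝒯 0 φ.2) {δ : ℝ} (hδ₁ : ‖η.1 - φ.1‖ ≤ δ)
    (hδ₂ : ‖η.2 - φ.2‖ ≤ δ) :
    |formA P η η' - Q.formAh 𝒯 P η η'| ≤ (‖FS‖ + ‖FW‖) * (1 + C) * δ * pairNorm η' := by
  have h1 := QuadRule.abs_integral_sub_form_le hC hQ FS (S.isPW_fst h) (S.isPW_fst h') hφ₁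
    fun χ hχ => hex.form_fst h' hχ
  have h2 := QuadRule.abs_integral_sub_form_le hC hQ FW (S.isPW_snd h) (S.isPW_snd h') hφ₂
    fun χ hχ => hex.form_snd h' hχ
  have hδ : 0 ≤ δ := (norm_nonneg _).trans hδ₁
  have h3 : ‖FS‖ * (1 + C) * ‖η.1 - φ.1‖ * ‖η'.1‖ ≤ ‖FS‖ * (1 + C) * δ * pairNorm η' := by
    gcongr
    exact norm_fst_le_pairNorm η'
  have h4 : ‖FW‖ * (1 + C) * ‖η.2 - φ.2‖ * ‖η'.2‖ ≤ ‖FW‖ * (1 + C) * δ * pairNorm η' := by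
    gcongr
    exact norm_snd_le_pairNorm η'
  rw [formA_eq hS hW, QuadRule.formAh, hS, hW, add_sub_add_comm]
  refine (abs_add_le _ _).trans ?_
  linarith

/-- The divergences of the stress error. -/
theorem FESpaces.normXh_sub_le (hΩ : IsOpen Ω)
    (hb : Bornology.IsBounded Ω) (hΓ : Γn ⊆ frontier Ω)
    {S : FESpaces Γn ell 𝒯} (hdiv : ∀ σ ∈ S.Sh, divS Γn σ ∈ S.Uh)
    {FA : Mat d d →L[ℝ] Vec (rotDim d)} (hFA : asym d = FA) {η η' : Stress Ω}
    (hη : MemX Ω Γn ell η) (hη' : η' ∈ S.Xh) (horth : ∀ v ∈ S.Yh, formB Γn ell (η' - η) v = 0)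
    {φ : L2 Ω (Vec d)} (hφ : φ ∈ S.Uh) {δ : ℝ} (hδ : ‖divS Γn η.1 - φ‖ ≤ δ) :
    S.normXh (η' - η) ≤ (2 + ‖FA‖) * pairNorm (η' - η) + δ := by
  have hX := S.memX hη'
  have hsub : divS Γn (η' - η).1 = divS Γn η'.1 - divS Γn η.1 := by
    have := divS_add_smul hΩ hb hΓ hX.1 hη.1 (-1)
    simpa [sub_eq_add_neg] using this
  have hB : ∀ v ∈ S.Yh, -inner ℝ (divS Γn (η' - η).1) v.1 + inner ℝ (FA.compLp (η' - η).1) v.2 -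
      inner ℝ (divW Γn ell (η' - η).2) v.2 = 0 := fun v hv => by
    rw [← formAsym_eq hFA]
    exact horth v hv
  have h1 : ‖divS Γn (η' - η).1‖ ≤ δ := by
    rw [hsub]
    set z := divS Γn η'.1 - divS Γn η.1
    -- By ∇·Σ_h ⊆ U_h the discrete divergence minus φ is an admissible displacement; orthogonality
    -- to it gives the best-approximation bound.
    have h0 : inner ℝ z (divS Γn η'.1 - φ) = 0 := by
      have := hB (divS Γn η'.1 - φ, 0) ⟨S.Uh.sub_mem (hdiv _ hη'.1) hφ, S.Rh.zero_mem⟩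
      rw [hsub] at this
      simpa using this
    have h2 : ‖z‖ ^ 2 ≤ ‖z‖ * δ := by
      have e : z = (divS Γn η'.1 - φ) - (divS Γn η.1 - φ) := by simp [z]
      calc ‖z‖ ^ 2 = inner ℝ z z := (real_inner_self_eq_norm_sq z).symm
        _ = inner ℝ z ((divS Γn η'.1 - φ) - (divS Γn η.1 - φ)) := by rw [← e]
        _ = -inner ℝ z (divS Γn η.1 - φ) := by rw [inner_sub_right, h0, zero_sub]
        _ ≤ ‖z‖ * ‖divS Γn η.1 - φ‖ :=
            (neg_le_abs _).trans (abs_real_inner_le_norm _ _)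
        _ ≤ ‖z‖ * δ := by gcongr
    by_contra! hlt
    have hz : 0 < ‖z‖ := ((norm_nonneg _).trans hδ).trans_lt hlt
    rw [pow_two] at h2
    exact absurd (le_of_mul_le_mul_left h2 hz) (not_le.2 hlt)
  -- Testing with rotations alone, the errors of ∇·ℓω and of asym σ have the same inner products
  -- with R_h.
  have h2 : ‖l2Proj S.Rh (divW Γn ell (η' - η).2)‖ ≤ ‖FA‖ * ‖(η' - η).1‖ := by
    refine (norm_l2Proj_le (a := FA.compLp (η' - η).1) fun r hr => ?_).trans (FA.norm_compLp_le _)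
    have := hB (0, r) ⟨S.Uh.zero_mem, hr⟩
    rw [inner_zero_right, neg_zero, zero_add, sub_eq_zero] at this
    exact this.symm
  have h3 := norm_fst_le_pairNorm (η' - η)
  have h4 := norm_snd_le_pairNorm (η' - η)
  have h5 : ‖FA‖ * ‖(η' - η).1‖ ≤ ‖FA‖ * pairNorm (η' - η) := by gcongr
  have h6 : S.normXh (η' - η) ≤ ‖(η' - η).1‖ + ‖divS Γn (η' - η).1‖ + ‖(η' - η).2‖ +
      ‖l2Proj S.Rh (divW Γn ell (η' - η).2)‖ := by
    refine Real.sqrt_le_iff.2 ⟨by positivity, ?_⟩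
    have a1 := norm_nonneg (η' - η).1
    have a2 := norm_nonneg (divS Γn (η' - η).1)
    have a3 := norm_nonneg (η' - η).2
    have a4 := norm_nonneg (l2Proj S.Rh (divW Γn ell (η' - η).2))
    generalize ‖(η' - η).1‖ = x1 at *
    generalize ‖divS Γn (η' - η).1‖ = x2 at *
    generalize ‖(η' - η).2‖ = x3 at *
    generalize ‖l2Proj S.Rh (divW Γn ell (η' - η).2)‖ = x4 at *
    linarith [mul_nonneg a1 a2, mul_nonneg a1 a3, mul_nonneg a1 a4, mul_nonneg a2 a3,
      mul_nonneg a2 a4, mul_nonneg a3 a4, show (x1 + x2 + x3 + x4) ^ 2 = x1 ^ 2 + x2 ^ 2 + x3 ^ 2 +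
        x4 ^ 2 + 2 * (x1 * x2 + x1 * x3 + x1 * x4 + x2 * x3 + x2 * x4 + x3 * x4) by ring]
  linarith

end Consistency

end Cosserat

end

/-! ### The error estimate -/

theorem mainTheorem5 (d : ℕ) (hd : d = 2 ∨ d = 3)
    (Ω : Set (Cosserat.Pt d)) (hΩ : Cosserat.IsLipschitzDomain Ω)
    (Γe Γn : Set (Cosserat.Pt d)) (hΓ : Γe ∪ Γn = frontier Ω) (hdisj : Disjoint Γe Γn)
    (P : Cosserat.Material) {κ : Type} [Fintype κ] (Q : Cosserat.QuadRule d κ)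
    (L ρ β c₁ c₂ M K : ℝ) (hβ : 0 < β) (hc₁ : 0 < c₁) :
    ∃ C : ℝ, 0 < C ∧
      ∀ (ell : Cosserat.Pt d → ℝ) (_ : Cosserat.IsLengthScale Ω L ell)
        (𝒯 : Cosserat.Mesh Ω) (_ : 𝒯.ShapeRegular ρ)
        (S : Cosserat.FESpaces Γn ell 𝒯)
        (_ : ∀ u : Cosserat.L2 Ω (Cosserat.Vec d), Cosserat.IsPW 𝒯 0 u → u ∈ S.Uh)
        (_ : ∀ σ ∈ S.Sh, Cosserat.divS Γn σ ∈ S.Uh)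
        (_ : S.ElasticityStable β)
        (_ : Q.NormEquiv S c₁ c₂)
        (_ : Q.Exact S)
        (g : Cosserat.Stress Ω →ₗ[ℝ] ℝ) (_ : Cosserat.IsDualX Γn ell g)
        (f : Cosserat.Kinem Ω)
        (η : Cosserat.Stress Ω) (v : Cosserat.Kinem Ω)
        (_ : Cosserat.IsSolution Γn P ell g f η v)
        (_ : Cosserat.H1NormLE Ω η.1 M) (_ : Cosserat.H1NormLE Ω η.2 M)
        (_ : Cosserat.H1NormLE Ω (Cosserat.divS Γn η.1) M)
        (ηh : Cosserat.Stress Ω) (vh : Cosserat.Kinem Ω)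
        (_ : S.IsMFE P g f ηh vh)
        (_ : Cosserat.pairNorm (ηh - η) + Cosserat.pairNorm (vh - v) ≤ K * 𝒯.size),
        (∃! p : Cosserat.Stress Ω × Cosserat.Kinem Ω, S.IsMSMFE Q P g f p.1 p.2) ∧
        ∀ (ηhat : Cosserat.Stress Ω) (vhat : Cosserat.Kinem Ω),
          S.IsMSMFE Q P g f ηhat vhat →
          S.normXh (ηhat - η) + Cosserat.pairNorm (vhat - v) ≤ C * 𝒯.size := by
  obtain ⟨FS, hFS, α₁, hα₁, hS⟩ := P.exists_AS_clm d
  obtain ⟨FW, hFW, α₂, hα₂, hW⟩ := P.exists_AW_clm hd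
  obtain ⟨FA, hFA⟩ := Cosserat.exists_asym_clm hd
  obtain ⟨CQ, hCQ, hQ⟩ := Q.exists_form_id_le ρ
  have hΩo := hΩ.1
  have hb := hΩ.2.2.1
  have hΓn : Γn ⊆ frontier Ω := hΓ ▸ Set.subset_union_right
  set α := min α₁ α₂
  have hα : 0 < α := lt_min hα₁ hα₂
  set a := α * c₁ ^ 2
  have ha : 0 < a := by positivity
  set CA := (‖FS‖ + ‖FW‖) * CQ
  have hCA : 0 ≤ CA := by positivity
  set C₀ := (‖FS‖ + ‖FW‖) * (1 + CQ) * (|K| + 2 ^ d * |M|)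
  have hC₀ : 0 ≤ C₀ := by positivity
  -- The first two summands bound the stress error in the X_h norm, the bracket bounds the error of
  -- displacement and rotation, and the final 1 ensures strict positivity. Absolute values appear
  -- because K and M carry no sign assumption.
  refine ⟨(2 + ‖FA‖) * (C₀ / a + |K|) + 2 ^ d * |M| + (2 / β * (CA * (C₀ / a) + C₀) + |K|) + 1,
    by positivity, ?_⟩
  intro ell hell 𝒯 hρ S hP0 hdiv hst hNE hEx g _ f η v hsol hr₁ hr₂ hr₃ ηh vh hmfe herr
  have hsz := 𝒯.size_nonneg
  have hQ' : ∀ {ι : Type} [Fintype ι] (φ : Cosserat.L2 Ω (EuclideanSpace ℝ ι)),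
      Cosserat.IsPW 𝒯 2 φ → Q.form 𝒯 id φ φ ≤ CQ * ‖φ‖ ^ 2 := fun φ hφ => hQ 𝒯 hρ φ hφ
  have hcoer : ∀ η ∈ S.Xh, a * Cosserat.pairNorm η ^ 2 ≤ Q.formAh 𝒯 P η η := fun η h =>
    Cosserat.FESpaces.formAh_coercive hc₁ hNE hα.le
      (fun τ => by
        rw [hFS]
        exact le_trans (by gcongr; exact min_le_left _ _) (hS τ))
      (fun τ => by
        rw [hFW]
        exact le_trans (by gcongr; exact min_le_right _ _) (hW τ)) h
  have hbdd : ∀ η ∈ S.Xh, ∀ η' ∈ S.Xh, |Q.formAh 𝒯 P η η'| ≤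
      CA * Cosserat.pairNorm η * Cosserat.pairNorm η' := fun η h η' h' =>
    Cosserat.FESpaces.abs_formAh_le hCQ hQ' hFS hFW h h'
  constructor
  · refine Cosserat.FESpaces.existsUnique_isMSMFE hd hΩo hb hΓn hell (fun e he w hw heq => ?_) g f
    obtain ⟨h1, h2⟩ := Cosserat.FESpaces.stability hd hΩo hb hΓn hell ha hβ hcoer hbdd hst
      (F := fun _ => 0) (ε := 0) (fun η _ => by simp) he hw heq le_rfl hCA
    rw [zero_div] at h1 h2
    rw [mul_zero, add_zero, mul_zero] at h2
    exact ⟨Cosserat.eq_zero_of_pairNorm_le_zero h1, Cosserat.eq_zero_of_pairNorm_le_zero h2⟩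
  · intro ηhat vhat hms
    obtain ⟨φ₁, hφ₁, hφ₁'⟩ := Cosserat.exists_isPW_zero_norm_sub_le hΩ 𝒯 hr₁
    obtain ⟨φ₂, hφ₂, hφ₂'⟩ := Cosserat.exists_isPW_zero_norm_sub_le hΩ 𝒯 hr₂
    obtain ⟨φ₃, hφ₃, hφ₃'⟩ := Cosserat.exists_isPW_zero_norm_sub_le hΩ 𝒯 hr₃
    have hMM : 2 ^ d * M * 𝒯.size ≤ 2 ^ d * |M| * 𝒯.size := by
      gcongr
      exact le_abs_self M
    have hKK : K * 𝒯.size ≤ |K| * 𝒯.size := by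
      gcongr
      exact le_abs_self K
    have hηh : Cosserat.pairNorm (ηh - η) ≤ |K| * 𝒯.size := by
      have := Cosserat.pairNorm_nonneg (vh - v)
      linarith
    have hvh : Cosserat.pairNorm (vh - v) ≤ |K| * 𝒯.size := by
      have := Cosserat.pairNorm_nonneg (ηh - η)
      linarith
    set δ := (|K| + 2 ^ d * |M|) * 𝒯.size
    have hδ₁ : ‖ηh.1 - φ₁‖ ≤ δ := by
      have h1 := norm_sub_le_norm_sub_add_norm_sub ηh.1 η.1 φ₁
      have h2 : ‖ηh.1 - η.1‖ ≤ _ := Cosserat.norm_fst_le_pairNorm (ηh - η)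
      simp only [δ, add_mul]
      linarith
    have hδ₂ : ‖ηh.2 - φ₂‖ ≤ δ := by
      have h1 := norm_sub_le_norm_sub_add_norm_sub ηh.2 η.2 φ₂
      have h2 : ‖ηh.2 - η.2‖ ≤ _ := Cosserat.norm_snd_le_pairNorm (ηh - η)
      simp only [δ, add_mul]
      linarith
    have heX : ηhat - ηh ∈ S.Xh := S.Xh.sub_mem hms.1 hmfe.1
    have hwY : vhat - vh ∈ S.Yh := S.Yh.sub_mem hms.2.1 hmfe.2.1
    -- Both methods have the same data and the same form B, so the difference of the solutions sees
    -- only the defect A − A_h at the MFE stress.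
    have heq : ∀ η' ∈ S.Xh, ∀ v' ∈ S.Yh, Q.formAh 𝒯 P (ηhat - ηh) η' -
        Cosserat.formB Γn ell η' (vhat - vh) + Cosserat.formB Γn ell (ηhat - ηh) v' =
        Cosserat.formA P ηh η' - Q.formAh 𝒯 P ηh η' := fun η' hη' v' hv' => by
      have e1 := Cosserat.FESpaces.formAh_add_smul_left (Q := Q) (P := P) hd S hms.1 hmfe.1 (-1) η'
      have e2 := Cosserat.formB_add_smul_right (Γn := Γn) (ell := ell) hd η' vhat vh (-1)
      have e3 := Cosserat.formB_add_smul_left hd hΩo hb hΓn hell (S.memX hms.1) (S.memX hmfe.1)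
        (-1) v'
      have e4 := hms.2.2 η' hη' v' hv'
      have e5 := hmfe.2.2 η' hη' v' hv'
      rw [neg_one_smul, ← sub_eq_add_neg] at e1 e2 e3
      linarith
    have hF : ∀ η' ∈ S.Xh, |Cosserat.formA P ηh η' - Q.formAh 𝒯 P ηh η'| ≤
        C₀ * 𝒯.size * Cosserat.pairNorm η' := fun η' hη' => by
      have := Cosserat.FESpaces.abs_formA_sub_formAh_le (φ := (φ₁, φ₂)) hCQ hQ' hEx hFS hFW hmfe.1
        hη' hφ₁ hφ₂ hδ₁ hδ₂
      refine this.trans (le_of_eq ?_)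
      simp only [C₀, δ]
      ring
    obtain ⟨he, hw⟩ := Cosserat.FESpaces.stability hd hΩo hb hΓn hell ha hβ hcoer hbdd hst hF heX
      hwY heq (by positivity) hCA
    have hη : Cosserat.pairNorm (ηhat - η) ≤ (C₀ / a + |K|) * 𝒯.size := by
      have h1 := Cosserat.pairNorm_add_le (ηhat - ηh) (ηh - η)
      rw [sub_add_sub_cancel] at h1
      have h2 : C₀ * 𝒯.size / a = C₀ / a * 𝒯.size := by ring
      rw [add_mul]
      linarith
    have hv : Cosserat.pairNorm (vhat - v) ≤ (2 / β * (CA * (C₀ / a) + C₀) + |K|) * 𝒯.size := by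
      have h1 := Cosserat.pairNorm_add_le (vhat - vh) (vh - v)
      rw [sub_add_sub_cancel] at h1
      have h2 : 2 / β * (CA * (C₀ * 𝒯.size / a) + C₀ * 𝒯.size) =
        2 / β * (CA * (C₀ / a) + C₀) * 𝒯.size := by ring
      rw [add_mul]
      linarith
    -- The test stress 0 isolates the second equation, which the exact solution satisfies as well;
    -- additivity is used only to see that the forms vanish at 0.
    have horth : ∀ v' ∈ S.Yh, Cosserat.formB Γn ell (ηhat - η) v' = 0 := fun v' hv' => by
      have e1 := hms.2.2 0 S.Xh.zero_mem v' hv'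
      have e2 := hsol.2.2 v'
      have e3 := Cosserat.formB_add_smul_left hd hΩo hb hΓn hell (S.memX hms.1) hsol.1 (-1) v'
      have e4 := S.formAh_add_smul_right (Q := Q) (P := P) S.Xh.zero_mem S.Xh.zero_mem 1 ηhat
      have e5 := Cosserat.formB_add_smul_left hd hΩo hb hΓn hell (S.memX S.Xh.zero_mem)
        (S.memX S.Xh.zero_mem) 1 vhat
      rw [neg_one_smul, ← sub_eq_add_neg] at e3
      rw [one_smul, add_zero] at e4 e5
      rw [map_zero] at e1
      linarith
    have hX := Cosserat.FESpaces.normXh_sub_le hΩo hb hΓn hdiv hFA hsol.1 hms.1 horth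
      (hP0 φ₃ hφ₃) (hφ₃'.trans hMM)
    have h7 : (2 + ‖FA‖) * Cosserat.pairNorm (ηhat - η) ≤
        (2 + ‖FA‖) * ((C₀ / a + |K|) * 𝒯.size) := by gcongr
    calc S.normXh (ηhat - η) + Cosserat.pairNorm (vhat - v)
        ≤ ((2 + ‖FA‖) * ((C₀ / a + |K|) * 𝒯.size) + 2 ^ d * |M| * 𝒯.size) +
          (2 / β * (CA * (C₀ / a) + C₀) + |K|) * 𝒯.size + 1 * 𝒯.size := by linarith
      _ = _ := by ring
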